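/- Let $R$ be a commutative ring and let $(\mathcal C,\otimes,1,\sigma)$ be an $R$-linear symmetric monoidal category that has all (small) colimits, preserved by $\otimes$ in each variable. Let $Q=[s,t:Q_1\to Q_0]$ be a finite quiver, and let $\overline Q$ be its double, in which every $a\in Q_1$ has a reversed copy $\overline a$. For arrows $a,b$ of $\overline Q$ put $\langle a,b\rangle=1$ if $a\in Q_1$ and $b=\overline a$; $\langle a,b\rangle=-1$ if $b\in Q_1$ and $a=\overline b$; and $\langle a,b\rangle=0$ otherwise. Paths are read from left to right. *Necklace side.* Let $\mathcal N$ be the free $R$-module on the cyclic paths of $\overline Q$, i.e. closed paths up to cyclic permutation, including the constant path $e_i$ for each vertex $i$. Let $\mathrm{br}^+:\mathcal N\otimes\mathcal N\to\mathcal N$ be the linear map with $$\mathrm{br}^+(a_1\cdots a_m\otimes b_1\cdots b_n)=\sum_{i=1}^m\sum_{j=1}^n\langle a_i,b_j\rangle\,a_ia_{i+1}\cdots a_{i-1}a_i\,b_jb_{j+1}\cdots b_{j-1}b_j$$ (indices in the two words are cyclic), and $\mathrm{br}^+(e_i\otimes-)=0=\mathrm{br}^+(-\otimes e_i)$. Write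 $S\mathcal N$ for the free commutative $R$-algebra on $\mathcal N$, and extend $\mathrm{br}^+$ to $S\mathcal N$ as a bi-derivation. *Representation side.* For each vertex $i$ fix an object $c_i\in\mathcal C$ with dual $c_i^\vee$, evaluation $\mathrm{ev}:c_i^\vee\otimes c_i\to1$ and coevaluation $\mathrm{coev}:1\to c_i\otimes c_i^\vee$. Put $h_a^\vee=c_{s(a)}\otimes c_{t(a)}^\vee$ for each arrow $a$ of $\overline Q$ and $h^\vee=\bigoplus_{a}h_a^\vee$, and let $Sh^\vee$ be the free commutative monoid on $h^\vee$ in $\mathcal C$. Let $\{-,-\}^+:Sh^\vee\otimes Sh^\vee\to Sh^\vee$ be the unique bi-derivation (Leibniz rule in each variable) whose restriction to $h_a^\vee\otimes h_b^\vee$ is $0$ if $a,b$ are not in involution, and is otherwise $\langle a,b\rangle$ times the composite $$h_a^\vee\otimes h_b^\vee\longrightarrow h_a^\vee\otimes h_a^\vee\otimes h_b^\vee\otimes h_b^\vee\longrightarrow Sh^\vee,\qquad (x\otimes\varphi)\otimes(y\otimes\psi)\longmapsto(e\otimes\varphi)\cdot(x\otimes f')\cdot(f\otimes\psi)\cdot(y\otimes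 e').$$ Here elements are a shorthand for the corresponding string diagram: $e\otimes e'$ and $f\otimes f'$ stand for the coevaluations of $c_{s(a)}=c_{t(b)}$ and $c_{s(b)}=c_{t(a)}$, the symmetry $\sigma$ permutes the tensor factors, and the second arrow includes the four factors in $Sh^\vee$ and multiplies. The $R$-module $\mathcal C(1,Sh^\vee)$ is a commutative $R$-algebra via the multiplication of $Sh^\vee$, and it carries the induced bracket, which sends $f,g:1\to Sh^\vee$ to the composite $1\cong1\otimes1\xrightarrow{f\otimes g}Sh^\vee\otimes Sh^\vee\xrightarrow{\{-,-\}^+}Sh^\vee$. *The trace map.* Let $\mathrm{tr}:S\mathcal N\to\mathcal C(1,Sh^\vee)$ be the map of commutative $R$-algebras given on cyclic paths as follows. $\mathrm{tr}(e_i)$ is the circle $\mathrm{ev}\circ\sigma\circ\mathrm{coev}:1\to1$ coloured by $c_i$, followed by the unit $1\to Sh^\vee$. For a closed path $a_1\cdots a_n$ with $n\ge1$, $\mathrm{tr}(a_1\cdots a_n)$ is the composite $$1\longrightarrow h_{a_1}^\vee\otimes\cdots\otimes h_{a_n}^\vee\longrightarrow Sh^\vee$$ in which the first arrow consists of $n$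 coevaluation strands, the $k$-th one connecting the factor $c_{t(a_k)}^\vee$ of $h_{a_k}^\vee$ with the factor $c_{s(a_{k+1})}$ of $h_{a_{k+1}}^\vee$ (indices modulo $n$), and the second arrow includes the factors in $Sh^\vee$ and multiplies. **Proposition.** The map $\mathrm{tr}$ is a well-defined map of commutative $R$-algebras with these values (in particular they do not depend on the chosen startpoint of a closed path), and it intertwines the brackets $\mathrm{br}^+$ and $\{-,-\}^+$: $$\mathrm{tr}\bigl(\mathrm{br}^+(X\otimes Y)\bigr)=\{\mathrm{tr}(X),\mathrm{tr}(Y)\}^+\qquad\text{for all }X,Y\in S\mathcal N.$$ -/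

import Mathlib

open CategoryTheory MonoidalCategory Limits

universe v u w

namespace NecklaceTrace

set_option linter.unusedSectionVars false

section Swap
variable {C : Type u} [Category.{v} C] [MonoidalCategory C] [SymmetricCategory C]

/-- The exchange `a ⊗ (b ⊗ z) ⟶ b ⊗ (a ⊗ z)` of the first two factors. -/
def sw (a b z : C) : a ⊗ (b ⊗ z) ⟶ b ⊗ (a ⊗ z) :=
  (α_ a b z).inv ≫ (β_ a b).hom ▷ z ≫ (α_ b a z).hom

@[simp]
lemma sw_sw (a b z : C) : sw a b z ≫ sw b a z = 𝟙 _ := by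
  simp [sw, ← comp_whiskerRight_assoc]

@[simp]
lemma sw_sw_assoc (a b z : C) {w : C} (h : a ⊗ (b ⊗ z) ⟶ w) : sw a b z ≫ sw b a z ≫ h = h := by
  rw [← Category.assoc, sw_sw, Category.id_comp]

lemma sw_nat1 {a a' : C} (f : a ⟶ a') (b z : C) :
    f ▷ (b ⊗ z) ≫ sw a' b z = sw a b z ≫ b ◁ f ▷ z := by
  simp [sw, ← comp_whiskerRight_assoc]
lemma sw_nat2 {b b' : C} (a : C) (f : b ⟶ b') (z : C) :
    a ◁ f ▷ z ≫ sw a b' z = sw a b z ≫ f ▷ (a ⊗ z) := by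
  have h : (a ◁ f) ▷ z ≫ (β_ a b').hom ▷ z = (β_ a b).hom ▷ z ≫ (f ▷ a) ▷ z := by
    rw [← comp_whiskerRight, ← comp_whiskerRight, BraidedCategory.braiding_naturality_right]
  have h2 : a ◁ f ▷ z ≫ (α_ a b' z).inv = (α_ a b z).inv ≫ (a ◁ f) ▷ z := by simp
  simp only [sw, Category.assoc]
  rw [reassoc_of% h2, reassoc_of% h, associator_naturality_left]
lemma sw_nat3 (a b : C) {z z' : C} (f : z ⟶ z') :
    a ◁ b ◁ f ≫ sw a b z' = sw a b z ≫ b ◁ a ◁ f := by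
  simp only [sw, Category.assoc]
  rw [← associator_naturality_right, ← whisker_exchange_assoc, ← associator_inv_naturality_right_assoc]

/-- Moving `a ⊗ b` past `c`. -/
lemma sw_tensor1 (a b c z : C) :
    (α_ a b (c ⊗ z)).hom ≫ a ◁ sw b c z ≫ sw a c (b ⊗ z) =
      sw (a ⊗ b) c z ≫ c ◁ (α_ a b z).hom := by
  simp [sw, BraidedCategory.braiding_tensor_left_hom]
lemma sw_tensor2 (a b c z : C) :
    a ◁ (α_ b c z).hom ≫ sw a b (c ⊗ z) ≫ b ◁ sw a c z =
      sw a (b ⊗ c) z ≫ (α_ b c (a ⊗ z)).hom  := by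
  simp [sw, BraidedCategory.braiding_tensor_right_hom]
lemma sw_braid (a b c z : C) :
    sw a b (c ⊗ z) ≫ b ◁ sw a c z ≫ sw b c (a ⊗ z) =
      a ◁ sw b c z ≫ sw a c (b ⊗ z) ≫ c ◁ sw a b z := by
  have h1 := sw_tensor1 a b c z
  have h2 := sw_tensor1 b a c z
  rw [← cancel_epi (α_ a b (c ⊗ z)).hom, reassoc_of% h1]
  have : (α_ a b (c ⊗ z)).hom ≫ sw a b (c ⊗ z) = (β_ a b).hom ▷ (c ⊗ z) ≫ (α_ b a (c ⊗ z)).hom := by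
    simp [sw]
  rw [reassoc_of% this, h2, reassoc_of% sw_nat1]
  simp [sw]
lemma sw_unit1 (b z : C) : sw (𝟙_ C) b z = (λ_ _).hom ≫ b ◁ (λ_ z).inv := by
  simp [sw, braiding_tensorUnit_left]
lemma sw_unit2 (a z : C) : sw a (𝟙_ C) z = a ◁ (λ_ z).hom ≫ (λ_ _).inv := by
  simp [sw, braiding_tensorUnit_right]
lemma sw_whiskerRight (a b z y : C) : sw a b z ▷ y ≫ (α_ _ _ _).hom ≫ b ◁ (α_ _ _ _).hom =
    (α_ _ _ _).hom ≫ a ◁ (α_ _ _ _).hom ≫ sw a b (z ⊗ y) := by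
  simp [sw]
end Swap

section Joint
variable {C : Type u} [Category.{v} C]

lemma ext_of_preserves {D : Type u} [Category.{v} D] (F : C ⥤ D) (f : ℕ → C) [HasCoproduct f]
    [PreservesColimit (Discrete.functor f) F] {Z : D} {g h : F.obj (∐ f) ⟶ Z}
    (H : ∀ n, F.map (Sigma.ι f n) ≫ g = F.map (Sigma.ι f n) ≫ h) : g = h :=
  (isColimitOfPreserves F (coproductIsCoproduct f)).hom_ext (fun ⟨n⟩ => H n)

lemma desc_of_preserves (F : C ⥤ C) (f : ℕ → C) [HasCoproduct f]
    [PreservesColimit (Discrete.functor f) F] {Z : C} (g : ∀ n, F.obj (f n) ⟶ Z) :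
    ∃ h : F.obj (∐ f) ⟶ Z, ∀ n, F.map (Sigma.ι f n) ≫ h = g n :=
  ⟨(isColimitOfPreserves F (coproductIsCoproduct f)).desc ⟨Z, Discrete.natTrans fun ⟨n⟩ => g n⟩,
    fun n => (isColimitOfPreserves F (coproductIsCoproduct f)).fac _ ⟨n⟩⟩
end Joint

/-- `C` has all small colimits, and `⊗` preserves them in each variable. -/
class TensorCocomplete (C : Type u) [Category.{v} C] [MonoidalCategory C] : Prop where
  hasColimits : HasColimits C
  tensorLeft_preserves : ∀ X : C, PreservesColimits (tensorLeft X)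
  tensorRight_preserves : ∀ X : C, PreservesColimits (tensorRight X)

section Sym
variable {C : Type u} [Category.{v} C] [MonoidalCategory C]

instance [TensorCocomplete C] : HasColimits C := TensorCocomplete.hasColimits
instance [TensorCocomplete C] (X : C) : PreservesColimitsOfSize.{0, 0} (tensorLeft X) :=
  have := TensorCocomplete.tensorLeft_preserves X
  preservesSmallestColimits_of_preservesColimits _
instance [TensorCocomplete C] (X : C) : PreservesColimitsOfSize.{0, 0} (tensorRight X) :=
  have := TensorCocomplete.tensorRight_preserves X
  preservesSmallestColimits_of_preservesColimits _

variable [SymmetricCategory C] [TensorCocomplete C]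

/-- Two consecutive symmetric powers `A = Sⁿ x`, `B = Sⁿ⁺¹ x` with the multiplication map
`x ⊗ A ⟶ B`. -/
structure SymStage (x : C) where
  A : C
  B : C
  act : x ⊗ A ⟶ B

/-- `S⁰ x = 1`, `S¹ x = x`, and `Sⁿ⁺² x` is the quotient of `x ⊗ Sⁿ⁺¹ x` that identifies
`a ⊗ (b · z)` with `b ⊗ (a · z)`. -/
noncomputable def symStage (x : C) : ℕ → SymStage x
  | 0 => ⟨𝟙_ C, x, (ρ_ x).hom⟩
  | n + 1 => ⟨(symStage x n).B,
      coequalizer (x ◁ (symStage x n).act) (sw x x _ ≫ x ◁ (symStage x n).act),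
      coequalizer.π _ _⟩

/-- The `n`-th symmetric power `Sⁿ x`. -/
noncomputable def symPow (x : C) (n : ℕ) : C := (symStage x n).A

/-- The multiplication `x ⊗ Sⁿ x ⟶ Sⁿ⁺¹ x`. -/
noncomputable def symStep (x : C) (n : ℕ) : x ⊗ symPow x n ⟶ symPow x (n + 1) :=
  (symStage x n).act

/-- The underlying object of the free commutative monoid on `x`. -/
noncomputable def Sym (x : C) : C := ∐ symPow x

namespace Sym

/-- The inclusion of the `n`-th symmetric power. -/
noncomputable def incl (x : C) (n : ℕ) : symPow x n ⟶ Sym x := Sigma.ι (symPow x) n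

lemma symStep_swap (x : C) (n : ℕ) :
    sw x x _ ≫ x ◁ symStep x n ≫ symStep x (n + 1) = x ◁ symStep x n ≫ symStep x (n + 1) := by
  have := coequalizer.condition (x ◁ (symStage x n).act) (sw x x _ ≫ x ◁ (symStage x n).act)
  rw [Category.assoc] at this
  exact this.symm

lemma hom_ext_map (F : C ⥤ C) [PreservesColimitsOfSize.{0, 0} F] {x Z : C}
    {g h : F.obj (Sym x) ⟶ Z}
    (H : ∀ n, F.map (incl x n) ≫ g = F.map (incl x n) ≫ h) : g = h :=
  ext_of_preserves F _ H

lemma exists_map (F : C ⥤ C) [PreservesColimitsOfSize.{0, 0} F] {x Z : C}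
    (g : ∀ n, F.obj (symPow x n) ⟶ Z) :
    ∃ h : F.obj (Sym x) ⟶ Z, ∀ n, F.map (incl x n) ≫ h = g n :=
  desc_of_preserves F _ g

lemma exists_act (x : C) : ∃ h : x ⊗ Sym x ⟶ Sym x,
    ∀ n, x ◁ incl x n ≫ h = symStep x n ≫ incl x (n + 1) :=
  exists_map (tensorLeft x) _

/-- Multiplication by a generator, `x ⊗ S x ⟶ S x`. -/
noncomputable def act (x : C) : x ⊗ Sym x ⟶ Sym x := (exists_act x).choose

lemma incl_act (x : C) (n : ℕ) : x ◁ incl x n ≫ act x = symStep x n ≫ incl x (n + 1) :=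
  (exists_act x).choose_spec n

lemma act_swap (x : C) : sw x x _ ≫ x ◁ act x ≫ act x = x ◁ act x ≫ act x := by
  refine hom_ext_map (tensorLeft x ⋙ tensorLeft x) fun n => ?_
  change x ◁ x ◁ incl x n ≫ _ = x ◁ x ◁ incl x n ≫ _
  rw [reassoc_of% sw_nat3]
  have : x ◁ x ◁ incl x n ≫ x ◁ act x ≫ act x =
      x ◁ symStep x n ≫ symStep x (n + 1) ≫ incl x (n + 2) := by
    rw [← whiskerLeft_comp_assoc, incl_act, whiskerLeft_comp_assoc, incl_act]
  rw [this, reassoc_of% symStep_swap]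

/-- The unit of the free commutative monoid. -/
noncomputable def unit (x : C) : 𝟙_ C ⟶ Sym x := incl x 0

/-- The multiplication by a generator on `S x ⊗ Y`. -/
noncomputable def actR (x Y : C) : x ⊗ (Sym x ⊗ Y) ⟶ Sym x ⊗ Y := (α_ _ _ _).inv ≫ act x ▷ Y

lemma actR_swap (x Y : C) : sw x x _ ≫ x ◁ actR x Y ≫ actR x Y = x ◁ actR x Y ≫ actR x Y := by
  have h := congrArg (fun f => f ▷ Y) (act_swap x)
  have h1 : x ◁ actR x Y ≫ actR x Y = (x ◁ (α_ _ _ _).inv) ≫ (α_ _ _ _).inv ≫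
    (x ◁ act x ≫ act x) ▷ Y := by
    simp [actR]
  rw [h1]
  conv_rhs => rw [← act_swap]
  rw [← cancel_epi (x ◁ (α_ _ _ _).hom), ← cancel_epi (α_ _ _ _).hom, ← reassoc_of% sw_whiskerRight]
  simp

section Lift
variable [Preadditive C] [MonoidalPreadditive C]
variable {x Y Z : C} (a : x ⊗ Z ⟶ Z) (τ : x ⊗ (Sym x ⊗ Y) ⟶ Z) (f : Y ⟶ Z)

/-- The compatibility needed for a map `g : S x ⊗ Y ⟶ Z` with
`g (b · s, y) = a (b, g (s, y)) + τ (b, s, y)` to exist. -/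
structure Compat : Prop where
  act_comm : sw x x Z ≫ x ◁ a ≫ a = x ◁ a ≫ a
  twist_comm : sw x x _ ≫ (x ◁ τ ≫ a + x ◁ actR x Y ≫ τ) = x ◁ τ ≫ a + x ◁ actR x Y ≫ τ

variable {a τ}

lemma exists_coeq {A B Q : C} {f g : A ⟶ B} (Y : C) (k : B ⊗ Y ⟶ Q)
    (h : f ▷ Y ≫ k = g ▷ Y ≫ k) : ∃ l, coequalizer.π f g ▷ Y ≫ l = k := by
  have H := isColimitOfHasCoequalizerOfPreservesColimit (tensorRight Y) f g
  exact ⟨(Cofork.IsColimit.desc' H k h).1, (Cofork.IsColimit.desc' H k h).2⟩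

lemma exists_step (H : Compat a τ) (n : ℕ) (p : symPow x n ⊗ Y ⟶ Z) (q : symPow x (n + 1) ⊗ Y ⟶ Z)
    (hpq : symStep x n ▷ Y ≫ q = (α_ _ _ _).hom ≫ (x ◁ p ≫ a + x ◁ (incl x n ▷ Y) ≫ τ)) :
    ∃ r, symStep x (n + 1) ▷ Y ≫ r =
      (α_ _ _ _).hom ≫ (x ◁ q ≫ a + x ◁ (incl x (n + 1) ▷ Y) ≫ τ) := by
  apply exists_coeq
  set W := x ◁ x ◁ p ≫ x ◁ a ≫ a +
    x ◁ x ◁ (incl x n ▷ Y) ≫ (x ◁ τ ≫ a + x ◁ actR x Y ≫ τ) with hW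
  have hsw : sw x x _ ≫ W = W := by
    rw [hW, Preadditive.comp_add, ← reassoc_of% sw_nat3, ← reassoc_of% sw_nat3, H.act_comm, H.twist_comm]
  have key : x ◁ (symStep x n ▷ Y) ≫ (x ◁ q ≫ a + x ◁ (incl x (n + 1) ▷ Y) ≫ τ) =
      x ◁ (α_ _ _ _).hom ≫ W := by
    have e1 : x ◁ (symStep x n ▷ Y) ≫ x ◁ (incl x (n + 1) ▷ Y) =
      x ◁ (α_ _ _ _).hom ≫ x ◁ x ◁ (incl x n ▷ Y) ≫ x ◁ actR x Y := by
      simp only [← whiskerLeft_comp, ← comp_whiskerRight, ← incl_act, actR]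
      simp
    rw [Preadditive.comp_add, ← whiskerLeft_comp_assoc, hpq, reassoc_of% e1, hW]
    simp only [whiskerLeft_comp, MonoidalPreadditive.whiskerLeft_add, Preadditive.comp_add, Preadditive.add_comp,
      Category.assoc, add_assoc]
  change (x ◁ symStep x n) ▷ Y ≫ _ = (sw x x _ ≫ x ◁ symStep x n) ▷ Y ≫ _
  rw [comp_whiskerRight, Category.assoc, associator_naturality_middle_assoc, key,
    reassoc_of% sw_whiskerRight, hsw]

/-- The components `Sⁿ x ⊗ Y ⟶ Z`, two at a time. -/
noncomputable def liftAux (H : Compat a τ) (f : Y ⟶ Z) : (n : ℕ) →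
    { p : (symPow x n ⊗ Y ⟶ Z) × (symPow x (n + 1) ⊗ Y ⟶ Z) // symStep x n ▷ Y ≫ p.2 =
      (α_ _ _ _).hom ≫ (x ◁ p.1 ≫ a + x ◁ (incl x n ▷ Y) ≫ τ) }
  | 0 => ⟨((λ_ Y).hom ≫ f, (ρ_ x).inv ▷ Y ≫ (α_ _ (symPow x 0) _).hom ≫
      (x ◁ (show symPow x 0 ⊗ Y ⟶ Z from (λ_ Y).hom ≫ f) ≫ a + x ◁ (incl x 0 ▷ Y) ≫ τ)), by
      change (ρ_ x).hom ▷ Y ≫ _ = _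
      exact hom_inv_whiskerRight_assoc _ _ _⟩
  | n + 1 => ⟨((liftAux H f n).1.2,
      (exists_step H n (liftAux H f n).1.1 (liftAux H f n).1.2 (liftAux H f n).2).choose),
      (exists_step H n (liftAux H f n).1.1 (liftAux H f n).1.2 (liftAux H f n).2).choose_spec⟩

lemma exists_lift (H : Compat a τ) (f : Y ⟶ Z) : ∃ g : Sym x ⊗ Y ⟶ Z,
    unit x ▷ Y ≫ g = (λ_ Y).hom ≫ f ∧ actR x Y ≫ g = x ◁ g ≫ a + τ := by
  obtain ⟨g, hg⟩ := exists_map (x := x) (tensorRight Y) (fun n => (liftAux H f n).1.1)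
  have hg : ∀ n, incl x n ▷ Y ≫ g = (liftAux H f n).1.1 := hg
  refine ⟨g, hg 0, ?_⟩
  refine hom_ext_map (tensorRight Y ⋙ tensorLeft x) fun n => ?_
  change x ◁ (incl x n ▷ Y) ≫ _ = x ◁ (incl x n ▷ Y) ≫ _
  have e : x ◁ (incl x n ▷ Y) ≫ actR x Y = (α_ _ _ _).inv ≫ symStep x n ▷ Y ≫
      incl x (n + 1) ▷ Y := by
    rw [← comp_whiskerRight, ← incl_act, actR]
    simp
  rw [reassoc_of% e, hg (n + 1), Preadditive.comp_add, ← whiskerLeft_comp_assoc, hg n]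
  have := (liftAux H f n).2
  change _ ≫ symStep x n ▷ Y ≫ (liftAux H f n).1.2 = _
  rw [this, Iso.inv_hom_id_assoc]

lemma epi_symStep (n : ℕ) (Y : C) : Epi (symStep x n ▷ Y) := by
  cases n with
  | zero =>
    change Epi ((ρ_ x).hom ▷ Y)
    infer_instance
  | succ n =>
    exact map_π_epi (tensorRight Y) _ _

lemma lift_unique {g h : Sym x ⊗ Y ⟶ Z} (a : x ⊗ Z ⟶ Z) (τ : x ⊗ (Sym x ⊗ Y) ⟶ Z)
    (h0 : unit x ▷ Y ≫ g = unit x ▷ Y ≫ h)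
    (hg : actR x Y ≫ g = x ◁ g ≫ a + τ) (hh : actR x Y ≫ h = x ◁ h ≫ a + τ) : g = h := by
  refine hom_ext_map (tensorRight Y) fun n => ?_
  change incl x n ▷ Y ≫ g = incl x n ▷ Y ≫ h
  induction n with
  | zero => exact h0
  | succ n ih =>
    have := epi_symStep (x := x) n Y
    have e : symStep x n ▷ Y ≫ incl x (n + 1) ▷ Y =
       (α_ _ _ _).hom ≫ x ◁ (incl x n ▷ Y) ≫ actR x Y := by
      rw [← comp_whiskerRight, ← incl_act, actR]
      simp
    rw [← cancel_epi (symStep x n ▷ Y), reassoc_of% e, reassoc_of% e, hg, hh]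
    simp only [Preadditive.comp_add, ← whiskerLeft_comp_assoc, ih]

end Lift

section Mon
variable [Preadditive C] [MonoidalPreadditive C]

lemma exists_mul (x : C) : ∃ g : Sym x ⊗ Sym x ⟶ Sym x,
    unit x ▷ Sym x ≫ g = (λ_ _).hom ≫ 𝟙 _ ∧ actR x _ ≫ g = x ◁ g ≫ act x + 0 :=
  exists_lift ⟨act_swap x, by simp⟩ _

/-- The multiplication of the free commutative monoid: the map that extends the identity and
commutes with multiplication by generators. -/
noncomputable def mul (x : C) : Sym x ⊗ Sym x ⟶ Sym x := (exists_mul x).choose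

lemma unit_mul (x : C) : unit x ▷ Sym x ≫ mul x = (λ_ _).hom := by
  rw [mul, (exists_mul x).choose_spec.1, Category.comp_id]

lemma actR_mul (x : C) : actR x _ ≫ mul x = x ◁ mul x ≫ act x := by
  rw [mul, (exists_mul x).choose_spec.2, add_zero]

lemma actR_nat (x : C) {Y Y' : C} (f : Y ⟶ Y') :
    actR x Y ≫ Sym x ◁ f = x ◁ Sym x ◁ f ≫ actR x Y' := by
  rw [actR, Category.assoc, ← whisker_exchange]
  simp [actR]

lemma actR_tensor (x Y W : C) :
    actR x (Y ⊗ W) ≫ (α_ _ _ _).inv = x ◁ (α_ _ _ _).inv ≫ (α_ _ _ _).inv ≫ actR x Y ▷ W := by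
  simp [actR]

lemma mul_unit (x : C) : Sym x ◁ unit x ≫ mul x = (ρ_ _).hom := by
  refine lift_unique (act x) 0 ?_ ?_ ?_
  · rw [← whisker_exchange_assoc, unit_mul]; simp [unitors_equal]
  · rw [reassoc_of% actR_nat, actR_mul]; simp
  · simp [actR]

lemma mul_assoc' (x : C) :
    mul x ▷ Sym x ≫ mul x = (α_ _ _ _).hom ≫ Sym x ◁ mul x ≫ mul x := by
  rw [← cancel_epi (α_ _ _ _).inv, Iso.inv_hom_id_assoc]
  refine lift_unique (act x) 0 ?_ ?_ ?_
  · rw [← whisker_exchange_assoc, unit_mul]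
    have : unit x ▷ (Sym x ⊗ Sym x) ≫ (α_ _ _ _).inv ≫ mul x ▷ Sym x =
      (α_ _ _ _).inv ≫ (unit x ▷ Sym x ≫ mul x) ▷ Sym x := by simp
    rw [reassoc_of% this, unit_mul]; simp
  · rw [reassoc_of% actR_tensor, ← comp_whiskerRight_assoc, actR_mul]
    have : (x ◁ mul x ≫ act x) ▷ Sym x = (α_ _ _ _).hom ≫ x ◁ mul x ▷ Sym x ≫ actR x _ := by
      simp [actR]
    rw [this]
    simp only [Category.assoc, actR_mul]
    simp
  · rw [reassoc_of% actR_nat, actR_mul]; simp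

lemma whisker_act_mul (x : C) : Sym x ◁ act x ≫ mul x = sw _ _ _ ≫ x ◁ mul x ≫ act x := by
  refine lift_unique (act x) 0 ?_ ?_ ?_
  · rw [← whisker_exchange_assoc, unit_mul, reassoc_of% sw_nat1, ← whiskerLeft_comp_assoc, unit_mul,
      sw_unit1]
    simp
  · rw [reassoc_of% actR_nat, actR_mul]; simp
  · have h : actR x (x ⊗ Sym x) ≫ sw (Sym x) x (Sym x) =
      x ◁ sw (Sym x) x (Sym x) ≫ sw x x _ ≫ x ◁ actR x _ := by
      have := sw_tensor1 x (Sym x) x (Sym x)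
      rw [actR, Category.assoc, sw_nat1, Iso.inv_comp_eq, reassoc_of% this]
      simp [actR]
    rw [reassoc_of% h, ← whiskerLeft_comp_assoc, actR_mul, whiskerLeft_comp_assoc,
      ← reassoc_of% sw_nat3, act_swap]
    simp

lemma mul_comm' (x : C) : (β_ (Sym x) (Sym x)).hom ≫ mul x = mul x := by
  refine lift_unique (act x) 0 ?_ ?_ ?_
  · rw [BraidedCategory.braiding_naturality_left_assoc, mul_unit, unit_mul]; simp
  · have h : actR x (Sym x) ≫ (β_ (Sym x) (Sym x)).hom = x ◁ (β_ _ _).hom ≫ sw _ _ _ ≫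
      Sym x ◁ act x := by
      rw [actR, Category.assoc, BraidedCategory.braiding_naturality_left]
      simp [BraidedCategory.braiding_tensor_left_hom, sw]
    rw [reassoc_of% h, whisker_act_mul, sw_sw_assoc]
    simp
  · rw [actR_mul]; simp

noncomputable instance (x : C) : MonObj (Sym x) where
  one := unit x
  mul := mul x
  one_mul := unit_mul x
  mul_one := mul_unit x
  mul_assoc := mul_assoc' x

noncomputable instance (x : C) : IsCommMonObj (Sym x) where
  mul_comm := mul_comm' x

/-- The inclusion of generators `x ⟶ S x`. -/
noncomputable def gen (x : C) : x ⟶ Sym x := (ρ_ x).inv ≫ x ◁ unit x ≫ act x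

lemma act_eq (x : C) : act x = gen x ▷ Sym x ≫ mul x := by
  have : gen x ▷ Sym x = (ρ_ x).inv ▷ Sym x ≫ (α_ _ _ _).hom ≫ x ◁ unit x ▷ Sym x ≫
     actR x _ := by
    simp [gen, actR]
  rw [this]
  simp only [Category.assoc, actR_mul]
  rw [← whiskerLeft_comp_assoc, unit_mul]
  simp

open MonObj in
/-- `Sym x` with `gen x` is the free commutative monoid on `x`. -/
theorem existsUnique_monHom (x : C) (A : C) [MonObj A] [IsCommMonObj A] (f : x ⟶ A) :
    ∃! g : Sym x ⟶ A, IsMonHom g ∧ gen x ≫ g = f := by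
  set a : x ⊗ A ⟶ A := f ▷ A ≫ μ with ha
  have hsw : sw x x A ≫ x ◁ a ≫ a = x ◁ a ≫ a := by
    have h1 : x ◁ a ≫ a = (α_ _ _ _).inv ≫ (f ⊗ₘ f) ▷ A ≫ μ ▷ A ≫ μ := by
      rw [MonObj.mul_assoc, ha, whiskerLeft_comp_assoc, whisker_exchange_assoc,
        tensorHom_def', comp_whiskerRight_assoc]
      simp
    rw [h1, sw]
    simp only [Category.assoc, Iso.hom_inv_id_assoc]
    rw [← comp_whiskerRight_assoc, ← comp_whiskerRight_assoc,
      ← BraidedCategory.braiding_naturality, Category.assoc, comp_whiskerRight_assoc]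
    simp
  obtain ⟨g, g0, g1⟩ := exists_lift (x := x) (τ := 0) (Y := 𝟙_ C) (a := a) ⟨hsw, by simp⟩ η[A]
  set k : Sym x ⟶ A := (ρ_ _).inv ≫ g with hk
  have k0 : unit x ≫ k = η := by
    rw [hk, rightUnitor_inv_naturality_assoc, g0]; simp [unitors_equal]
  have k1 : act x ≫ k = x ◁ k ≫ a := by
    have : act x ≫ (ρ_ _).inv = x ◁ (ρ_ _).inv ≫ actR x _ := by simp [actR]
    rw [hk, reassoc_of% this, g1]; simp
  have huniq : ∀ k' : Sym x ⟶ A, IsMonHom k' → gen x ≫ k' = f → act x ≫ k' = x ◁ k' ≫ a := by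
    intro k' h1 h2
    have h3 : mul x ≫ k' = (k' ⊗ₘ k') ≫ μ := IsMonHom.mul_hom k'
    rw [act_eq, Category.assoc, h3, ha, ← h2, MonoidalCategory.tensorHom_def', Category.assoc,
      ← whisker_exchange_assoc]
    simp
  clear_value k
  refine ⟨k, ⟨⟨k0, ?_⟩, ?_⟩, ?_⟩
  · change mul x ≫ k = _
    refine lift_unique a 0 ?_ ?_ ?_
    · rw [reassoc_of% unit_mul, MonoidalCategory.tensorHom_def, Category.assoc,
        ← comp_whiskerRight_assoc, k0, ← whisker_exchange_assoc]
      simp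
    · rw [reassoc_of% actR_mul, k1]; simp
    · have h1 : actR x (Sym x) ≫ (k ⊗ₘ k) = (α_ _ _ _).inv ≫ ((x ◁ k ≫ a) ⊗ₘ k) := by
        rw [actR, Category.assoc, ← k1]; simp [MonoidalCategory.tensorHom_def]
      rw [reassoc_of% h1, ha, MonoidalCategory.tensorHom_def']
      simp only [comp_whiskerRight, Category.assoc, MonObj.mul_assoc]
      have h2 : x ◁ Sym x ◁ k ≫ x ◁ k ▷ A = x ◁ (k ⊗ₘ k) := by
        rw [← whiskerLeft_comp, MonoidalCategory.tensorHom_def']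
      simp only [tensor_whiskerLeft, whisker_assoc, Category.assoc, Iso.inv_hom_id_assoc,
        reassoc_of% h2, MonoidalCategory.whiskerLeft_comp, add_zero]
      rw [whisker_exchange_assoc]
      simp
  · rw [gen, Category.assoc, Category.assoc, k1, ← whiskerLeft_comp_assoc, k0, ha,
      whisker_exchange_assoc]
    simp
  · rintro k' ⟨h1, h2⟩
    rw [← cancel_epi (ρ_ _).hom]
    refine lift_unique a 0 ?_ ?_ ?_
    · have : unit x ≫ k' = η := IsMonHom.one_hom k'
      rw [rightUnitor_naturality_assoc, rightUnitor_naturality_assoc, this, k0]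
    · have : actR x (𝟙_ C) ≫ (ρ_ _).hom = x ◁ (ρ_ _).hom ≫ act x := by simp [actR]
      rw [reassoc_of% this, huniq k' h1 h2]; simp
    · have : actR x (𝟙_ C) ≫ (ρ_ _).hom = x ◁ (ρ_ _).hom ≫ act x := by simp [actR]
      rw [reassoc_of% this, k1]; simp

end Mon

open MonObj in
/-- A bi-derivation on a commutative monoid: `{fg, h} = f {g, h} + g {f, h}` and
`{f, gh} = g {f, h} + {f, g} h`. -/
structure IsBiderivation {D : Type u} [Category.{v} D] [MonoidalCategory D] [SymmetricCategory D]
    [Preadditive D] {A : D} [MonObj A] (B : A ⊗ A ⟶ A) : Prop where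
  left : μ[A] ▷ A ≫ B = (α_ A A A).hom ≫ (A ◁ B ≫ μ[A] + sw A A A ≫ A ◁ B ≫ μ[A])
  right : A ◁ μ[A] ≫ B = sw A A A ≫ A ◁ B ≫ μ[A] + (α_ A A A).inv ≫ B ▷ A ≫ μ[A]

section Derivation
variable [Preadditive C] [MonoidalPreadditive C]

/-- `D : S x ⊗ Y ⟶ S x` is a derivation in the first variable:
`D (s t, y) = s D (t, y) + t D (s, y)`. -/
def IsDer {x Y : C} (D : Sym x ⊗ Y ⟶ Sym x) : Prop :=
  mul x ▷ Y ≫ D = (α_ _ _ _).hom ≫ (Sym x ◁ D ≫ mul x + sw _ _ _ ≫ Sym x ◁ D ≫ mul x)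

lemma mul_left_comm (x : C) :
    sw (Sym x) (Sym x) (Sym x) ≫ Sym x ◁ mul x ≫ mul x = Sym x ◁ mul x ≫ mul x := by
  have h : (β_ (Sym x) (Sym x)).hom ▷ Sym x ≫ mul x ▷ Sym x ≫ mul x = mul x ▷ Sym x ≫ mul x := by
    rw [← comp_whiskerRight_assoc, mul_comm']
  rw [mul_assoc'] at h
  simp [sw, h]

/-- The twist `(b, s, y) ↦ s δ (b, y)`. -/
noncomputable def derTwist {x Y : C} (δ : x ⊗ Y ⟶ Sym x) : x ⊗ (Sym x ⊗ Y) ⟶ Sym x :=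
  sw _ _ _ ≫ Sym x ◁ δ ≫ mul x

lemma derTwist_compat {x Y : C} (δ : x ⊗ Y ⟶ Sym x) : Compat (act x) (derTwist δ) where
  act_comm := act_swap x
  twist_comm := by
    have h : x ◁ actR x Y ≫ derTwist δ = sw x x _ ≫ x ◁ derTwist δ ≫ act x := by
      have h2 := sw_tensor2 x x (Sym x) Y
      have h3 : x ◁ (α_ x (Sym x) Y).inv ≫ sw x (x ⊗ Sym x) Y =
        sw x x (Sym x ⊗ Y) ≫ x ◁ sw x (Sym x) Y ≫ (α_ _ _ _).inv := by
        rw [← cancel_epi (x ◁ (α_ x (Sym x) Y).hom), whiskerLeft_hom_inv_assoc, reassoc_of% h2,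
          Iso.hom_inv_id, Category.comp_id]
      rw [derTwist, actR, whiskerLeft_comp, Category.assoc, reassoc_of% sw_nat2, reassoc_of% h3]
      have h4 : (α_ x (Sym x) (x ⊗ Y)).inv ≫ act x ▷ (x ⊗ Y) ≫ Sym x ◁ δ ≫ mul x =
        x ◁ (Sym x ◁ δ) ≫ x ◁ mul x ≫ act x := by
        have := actR_nat x δ
        rw [← actR_mul, ← reassoc_of% this]; simp [actR]
      rw [h4]; simp
    rw [h, Preadditive.comp_add, sw_sw_assoc, add_comm]

lemma exists_der {x Y : C} (δ : x ⊗ Y ⟶ Sym x) : ∃ D : Sym x ⊗ Y ⟶ Sym x,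
    IsDer D ∧ gen x ▷ Y ≫ D = δ := by
  obtain ⟨D, h0, h1⟩ := exists_lift (derTwist_compat δ) 0
  rw [Limits.comp_zero] at h0
  refine ⟨D, ?_, ?_⟩
  · rw [IsDer, ← cancel_epi (α_ _ _ _).inv, Iso.inv_hom_id_assoc]
    refine lift_unique (act x) (x ◁ ((α_ _ _ _).inv ≫ mul x ▷ Y) ≫ derTwist δ) ?_ ?_ ?_
    · have h2 : unit x ▷ (Sym x ⊗ Y) ≫ (α_ _ _ _).inv ≫ mul x ▷ Y = (λ_ _).hom := by
        have : unit x ▷ (Sym x ⊗ Y) ≫ (α_ _ _ _).inv ≫ mul x ▷ Y =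
          (α_ _ _ _).inv ≫ (unit x ▷ Sym x ≫ mul x) ▷ Y := by simp
        rw [this, unit_mul]; simp
      rw [reassoc_of% h2, Preadditive.comp_add, ← whisker_exchange_assoc, unit_mul,
        reassoc_of% sw_nat1, ← whiskerLeft_comp_assoc, h0]
      simp
    · rw [reassoc_of% actR_tensor, ← comp_whiskerRight_assoc, actR_mul]
      have : (x ◁ mul x ≫ act x) ▷ Y = (α_ _ _ _).hom ≫ x ◁ mul x ▷ Y ≫ actR x _ := by
        simp [actR]
      rw [this]
      simp only [Category.assoc, h1, Preadditive.comp_add]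
      simp
    · have e1 : actR x (Sym x ⊗ Y) ≫ Sym x ◁ D ≫ mul x = x ◁ (Sym x ◁ D ≫ mul x) ≫ act x := by
        rw [reassoc_of% actR_nat, actR_mul]; simp
      have e2 : actR x (Sym x ⊗ Y) ≫ sw (Sym x) (Sym x) Y =
          x ◁ sw (Sym x) (Sym x) Y ≫ sw x (Sym x) _ ≫ Sym x ◁ actR x _ := by
        have := sw_tensor1 x (Sym x) (Sym x) Y
        rw [actR, Category.assoc, sw_nat1, Iso.inv_comp_eq, reassoc_of% this]
        simp [actR]
      have e3 : x ◁ sw (Sym x) (Sym x) Y ≫ sw x (Sym x) _ ≫ Sym x ◁ (x ◁ D ≫ act x) ≫ mul x =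
          x ◁ (sw (Sym x) (Sym x) Y ≫ Sym x ◁ D ≫ mul x) ≫ act x := by
        rw [whiskerLeft_comp_assoc, whisker_act_mul, reassoc_of% sw_nat3, sw_sw_assoc]
        simp
      have e4 : x ◁ sw (Sym x) (Sym x) Y ≫ sw x (Sym x) _ ≫ Sym x ◁ derTwist δ ≫ mul x =
          x ◁ ((α_ _ _ _).inv ≫ mul x ▷ Y) ≫ derTwist δ := by
        have h2 := sw_tensor2 x (Sym x) (Sym x) Y
        have h3 : x ◁ (α_ (Sym x) (Sym x) Y).inv ≫ sw x (Sym x ⊗ Sym x) Y =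
          sw x (Sym x) (Sym x ⊗ Y) ≫ Sym x ◁ sw x (Sym x) Y ≫ (α_ _ _ _).inv := by
          rw [← cancel_epi (x ◁ (α_ (Sym x) (Sym x) Y).hom), whiskerLeft_hom_inv_assoc,
            reassoc_of% h2, Iso.hom_inv_id, Category.comp_id]
        have h5 := sw_braid x (Sym x) (Sym x) Y
        rw [derTwist, whiskerLeft_comp, whiskerLeft_comp, whiskerLeft_comp]
        simp only [Category.assoc]
        rw [← reassoc_of% h5, ← reassoc_of% sw_nat3, mul_left_comm, reassoc_of% sw_nat2, reassoc_of% h3,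
          ← whisker_exchange_assoc, mul_assoc']
        simp
      rw [Preadditive.comp_add, e1, reassoc_of% e2, ← whiskerLeft_comp_assoc, h1,
        MonoidalPreadditive.whiskerLeft_add, Preadditive.add_comp, Preadditive.comp_add,
        Preadditive.comp_add, e3, e4, MonoidalPreadditive.whiskerLeft_add, Preadditive.add_comp,
        add_assoc]
  · have : gen x ▷ Y = (ρ_ x).inv ▷ Y ≫ (α_ _ _ _).hom ≫ x ◁ unit x ▷ Y ≫ actR x Y := by
      simp [gen, actR]
    rw [this]
    simp only [Category.assoc, h1, Preadditive.comp_add, derTwist]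
    rw [← whiskerLeft_comp_assoc, h0, reassoc_of% sw_nat2, ← whisker_exchange_assoc, unit_mul, sw_unit2]
    simp

lemma IsDer.map_unit {x Y : C} {D : Sym x ⊗ Y ⟶ Sym x} (h : IsDer D) : unit x ▷ Y ≫ D = 0 := by
  set d := unit x ▷ Y ≫ D with hd
  have h1 : (𝟙_ C ◁ unit x) ▷ Y ≫ unit x ▷ Sym x ▷ Y ≫ mul x ▷ Y ≫ D = (λ_ (𝟙_ C)).hom ▷ Y ≫ d := by
    rw [hd, ← comp_whiskerRight_assoc (unit x ▷ Sym x), unit_mul, ← comp_whiskerRight_assoc,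
      leftUnitor_naturality, comp_whiskerRight_assoc]
  have h2 : (𝟙_ C ◁ unit x) ▷ Y ≫ unit x ▷ Sym x ▷ Y ≫ (α_ _ _ _).hom =
      (α_ _ _ _).hom ≫ 𝟙_ C ◁ unit x ▷ Y ≫ unit x ▷ (Sym x ⊗ Y) := by simp
  have h3 : 𝟙_ C ◁ unit x ▷ Y ≫ unit x ▷ (Sym x ⊗ Y) ≫ Sym x ◁ D ≫ mul x = (λ_ _).hom ≫ d := by
    rw [← whisker_exchange_assoc, unit_mul, ← whiskerLeft_comp_assoc]; simp [hd]
  have h4 : 𝟙_ C ◁ unit x ▷ Y ≫ unit x ▷ (Sym x ⊗ Y) ≫ sw _ _ _ ≫ Sym x ◁ D ≫ mul x =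
      (λ_ _).hom ≫ d := by
    rw [reassoc_of% sw_nat1, reassoc_of% sw_nat2, ← whisker_exchange_assoc, h3, sw_unit1]
    simp
  rw [h, reassoc_of% h2, Preadditive.comp_add, Preadditive.comp_add, h3, h4,
    Preadditive.comp_add] at h1
  have h5 : (α_ (𝟙_ C) (𝟙_ C) Y).hom ≫ (λ_ _).hom = (λ_ (𝟙_ C)).hom ▷ Y := by simp
  rw [reassoc_of% h5, add_eq_left] at h1
  rwa [← cancel_epi ((λ_ (𝟙_ C)).hom ▷ Y), comp_zero]

lemma IsDer.map_act {x Y : C} {D : Sym x ⊗ Y ⟶ Sym x} (h : IsDer D) :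
    actR x Y ≫ D = x ◁ D ≫ act x + derTwist (gen x ▷ Y ≫ D) := by
  have e : Sym.actR x Y = gen x ▷ (Sym x ⊗ Y) ≫ (α_ _ _ _).inv ≫ mul x ▷ Y := by
    rw [Sym.actR, act_eq]; simp
  rw [e, Category.assoc, Category.assoc, h, Iso.inv_hom_id_assoc, Preadditive.comp_add,
    ← whisker_exchange_assoc, ← act_eq, reassoc_of% sw_nat1, derTwist]
  simp

lemma IsDer.ext {x Y : C} {D E : Sym x ⊗ Y ⟶ Sym x} (hD : IsDer D) (hE : IsDer E)
    (h : gen x ▷ Y ≫ D = gen x ▷ Y ≫ E) : D = E :=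
  lift_unique (act x) (derTwist (gen x ▷ Y ≫ D)) (by rw [hD.map_unit, hE.map_unit]) hD.map_act
    (by rw [h, hE.map_act])

lemma IsDer.whisker {x Y Y' : C} {D : Sym x ⊗ Y ⟶ Sym x} (hD : IsDer D) (f : Y' ⟶ Y) :
    IsDer (Sym x ◁ f ≫ D) := by
  rw [IsDer, ← whisker_exchange_assoc, hD, MonoidalCategory.whiskerLeft_comp_assoc,
    ← reassoc_of% sw_nat3]
  simp

lemma IsDer.add {x Y : C} {D E : Sym x ⊗ Y ⟶ Sym x} (hD : IsDer D) (hE : IsDer E) :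
    IsDer (D + E) := by
  rw [IsDer, Preadditive.comp_add, hD, hE]
  simp only [MonoidalPreadditive.whiskerLeft_add, Preadditive.comp_add, Preadditive.add_comp]
  abel

lemma IsDer.mul_left {x Y : C} {D : Sym x ⊗ Y ⟶ Sym x} (hD : IsDer D) :
    IsDer (sw (Sym x) (Sym x) Y ≫ Sym x ◁ D ≫ mul x) := by
  have h1 := sw_tensor1 (Sym x) (Sym x) (Sym x) Y
  have h2 := sw_braid (Sym x) (Sym x) (Sym x) Y
  have h3 := mul_left_comm x
  rw [IsDer, reassoc_of% sw_nat1, ← MonoidalCategory.whiskerLeft_comp_assoc, hD]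
  simp only [MonoidalCategory.whiskerLeft_comp, MonoidalPreadditive.whiskerLeft_add,
    Preadditive.comp_add, Preadditive.add_comp, Category.assoc]
  rw [← reassoc_of% h1, ← reassoc_of% h1, ← reassoc_of% h2, ← reassoc_of% sw_nat3, h3]

/-- The derivation property in the second variable. -/
def IsDer2 {x W : C} (F : W ⊗ Sym x ⟶ Sym x) : Prop :=
  W ◁ mul x ≫ F = sw _ _ _ ≫ Sym x ◁ F ≫ mul x + (α_ _ _ _).inv ≫ F ▷ Sym x ≫ mul x

lemma swap_mul {x V : C} (F : V ⟶ Sym x) :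
    F ▷ Sym x ≫ mul x = (β_ _ _).hom ≫ Sym x ◁ F ≫ mul x := by
  rw [← BraidedCategory.braiding_naturality_left_assoc, mul_comm']

lemma isDer2_iff {x W : C} (F : W ⊗ Sym x ⟶ Sym x) : IsDer2 F ↔ IsDer ((β_ (Sym x) W).hom ≫ F) := by
  rw [IsDer, BraidedCategory.braiding_naturality_left_assoc,
    ← cancel_epi (β_ W (Sym x ⊗ Sym x)).hom, SymmetricCategory.symmetry_assoc, IsDer2, swap_mul]
  have h1 : (β_ W (Sym x ⊗ Sym x)).hom ≫ (α_ _ _ _).hom ≫ Sym x ◁ (β_ (Sym x) W).hom =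
      sw W _ _ := by
    simp [BraidedCategory.braiding_tensor_right_hom, sw, ← MonoidalCategory.whiskerLeft_comp]
  have h2 : (β_ W (Sym x ⊗ Sym x)).hom ≫ (α_ _ _ _).hom ≫ sw _ _ _ ≫
      Sym x ◁ (β_ (Sym x) W).hom = (α_ _ _ _).inv ≫ (β_ _ _).hom := by
    have e1 : (α_ (Sym x) (Sym x) W).hom ≫ sw _ _ _ = (β_ (Sym x) (Sym x)).hom ▷ W ≫
        (α_ _ _ _).hom := by simp [sw]
    rw [reassoc_of% e1, ← BraidedCategory.braiding_naturality_right_assoc]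
    simp [BraidedCategory.braiding_tensor_right_hom, BraidedCategory.braiding_tensor_left_hom,
      ← MonoidalCategory.whiskerLeft_comp]
  simp only [MonoidalCategory.whiskerLeft_comp, Preadditive.comp_add, Category.assoc]
  rw [reassoc_of% h1, reassoc_of% h2]

/-- Bi-derivations on `S x` are determined by, and can be prescribed freely on, generators. -/
theorem existsUnique_biderivation {x : C} (β : x ⊗ x ⟶ Sym x) :
    ∃! B : Sym x ⊗ Sym x ⟶ Sym x, IsBiderivation B ∧ (gen x ⊗ₘ gen x) ≫ B = β := by
  refine existsUnique_of_exists_of_unique ?_ ?_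
  · obtain ⟨D, hD, hD'⟩ := exists_der ((β_ x x).hom ≫ β)
    obtain ⟨B, hB, hB'⟩ := exists_der ((β_ x (Sym x)).hom ≫ D)
    have h2 : IsDer2 ((β_ x (Sym x)).hom ≫ D) := by
      rw [isDer2_iff]; simpa using hD
    refine ⟨B, ⟨hB, ?_⟩, ?_⟩
    · change Sym x ◁ mul x ≫ B = sw _ _ _ ≫ Sym x ◁ B ≫ mul x + (α_ _ _ _).inv ≫ B ▷ Sym x ≫ mul x
      have e : (α_ _ _ _).inv ≫ B ▷ Sym x ≫ mul x = Sym x ◁ (β_ _ _).hom ≫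
          (sw _ _ _ ≫ Sym x ◁ B ≫ mul x) := by
        rw [swap_mul]
        simp [sw, BraidedCategory.braiding_tensor_left_hom]
      rw [e]
      refine (hB.whisker _).ext (hB.mul_left.add (hB.mul_left.whisker _)) ?_
      rw [← e, ← whisker_exchange_assoc, hB', h2, Preadditive.comp_add, reassoc_of% sw_nat1,
        ← MonoidalCategory.whiskerLeft_comp_assoc, hB', ← hB']
      simp
    · rw [MonoidalCategory.tensorHom_def', Category.assoc, hB',
        BraidedCategory.braiding_naturality_right_assoc, hD']
      simp
  · rintro B B' ⟨⟨h1, h2⟩, h3⟩ ⟨⟨h1', h2'⟩, h3'⟩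
    have key : ∀ B : Sym x ⊗ Sym x ⟶ Sym x, IsDer2 B → IsDer2 (gen x ▷ _ ≫ B) := by
      intro B h
      rw [IsDer2, whisker_exchange_assoc, h, MonoidalCategory.whiskerLeft_comp_assoc,
        Preadditive.comp_add, reassoc_of% sw_nat1]
      simp
    refine IsDer.ext h1 h1' ?_
    rw [← cancel_epi (β_ (Sym x) x).hom]
    refine IsDer.ext ((isDer2_iff _).1 (key B h2)) ((isDer2_iff _).1 (key B' h2')) ?_
    rw [BraidedCategory.braiding_naturality_left_assoc,
      BraidedCategory.braiding_naturality_left_assoc,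
      ← MonoidalCategory.tensorHom_def'_assoc, ← MonoidalCategory.tensorHom_def'_assoc, h3, h3']

end Derivation
end Sym
end Sym

section Points
variable {C : Type u} [Category.{v} C] [MonoidalCategory C]

/-- The `1`-points of an object. -/
def Points (A : C) : Type v := 𝟙_ C ⟶ A

/-- The operation on `1`-points given by a map `A ⊗ A ⟶ A`, as for the lax monoidal functor
`C(1, -)`. -/
def Points.op {A : C} (B : A ⊗ A ⟶ A) (f g : Points A) : Points A :=
  (λ_ (𝟙_ C)).inv ≫ MonoidalCategoryStruct.tensorHom (C := C) f g ≫ B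

section
variable [SymmetricCategory C] [Preadditive C] [MonoidalPreadditive C]
  (A : C) [MonObj A] [IsCommMonObj A]

instance : AddCommGroup (Points A) := inferInstanceAs (AddCommGroup (𝟙_ C ⟶ A))

open MonObj in
/-- The commutative ring of `1`-points of a commutative monoid. -/
noncomputable instance : CommRing (Points A) where
  __ := (inferInstance : AddCommGroup (Points A))
  mul f g := Points.op μ[A] f g
  one := (η[A] : 𝟙_ C ⟶ A)
  left_distrib (f g h : 𝟙_ C ⟶ A) := by
    change (λ_ (𝟙_ C)).inv ≫ (f ⊗ₘ (g + h)) ≫ μ =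
      (λ_ (𝟙_ C)).inv ≫ (f ⊗ₘ g) ≫ μ + (λ_ (𝟙_ C)).inv ≫ (f ⊗ₘ h) ≫ μ
    simp [MonoidalPreadditive.tensor_add]
  right_distrib (f g h : 𝟙_ C ⟶ A) := by
    change (λ_ (𝟙_ C)).inv ≫ ((f + g) ⊗ₘ h) ≫ μ =
      (λ_ (𝟙_ C)).inv ≫ (f ⊗ₘ h) ≫ μ + (λ_ (𝟙_ C)).inv ≫ (g ⊗ₘ h) ≫ μ
    simp [MonoidalPreadditive.add_tensor]
  zero_mul (f : 𝟙_ C ⟶ A) := by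
    change (λ_ (𝟙_ C)).inv ≫ ((0 : 𝟙_ C ⟶ A) ⊗ₘ f) ≫ μ = 0
    simp
  mul_zero (f : 𝟙_ C ⟶ A) := by
    change (λ_ (𝟙_ C)).inv ≫ (f ⊗ₘ (0 : 𝟙_ C ⟶ A)) ≫ μ = 0
    simp
  mul_assoc (f g h : 𝟙_ C ⟶ A) := by
    change (λ_ (𝟙_ C)).inv ≫ (((λ_ (𝟙_ C)).inv ≫ (f ⊗ₘ g) ≫ μ) ⊗ₘ h) ≫ μ =
      (λ_ (𝟙_ C)).inv ≫ (f ⊗ₘ ((λ_ (𝟙_ C)).inv ≫ (g ⊗ₘ h) ≫ μ)) ≫ μ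
    have h1 : (((λ_ (𝟙_ C)).inv ≫ (f ⊗ₘ g) ≫ μ) ⊗ₘ h) =
      (λ_ (𝟙_ C)).inv ▷ _ ≫ ((f ⊗ₘ g) ⊗ₘ h) ≫ μ ▷ A := by
      rw [← tensorHom_id, ← tensorHom_id, MonoidalCategory.tensorHom_comp_tensorHom,
        MonoidalCategory.tensorHom_comp_tensorHom, Category.id_comp, Category.comp_id]
    have h2 : (f ⊗ₘ ((λ_ (𝟙_ C)).inv ≫ (g ⊗ₘ h) ≫ μ)) =
      _ ◁ (λ_ (𝟙_ C)).inv ≫ (f ⊗ₘ (g ⊗ₘ h)) ≫ A ◁ μ := by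
      rw [← id_tensorHom, ← id_tensorHom, MonoidalCategory.tensorHom_comp_tensorHom,
        MonoidalCategory.tensorHom_comp_tensorHom, Category.id_comp, Category.comp_id]
    rw [h1, h2]
    simp only [Category.assoc, MonObj.mul_assoc, associator_naturality_assoc]
    rw [← Category.assoc (whiskerRight _ _)]
    congr 3
    monoidal
  one_mul (f : 𝟙_ C ⟶ A) := by
    change (λ_ (𝟙_ C)).inv ≫ (η ⊗ₘ f) ≫ μ = f
    rw [MonoidalCategory.tensorHom_def']; simp
  mul_one (f : 𝟙_ C ⟶ A) := by
    change (λ_ (𝟙_ C)).inv ≫ (f ⊗ₘ η) ≫ μ = f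
    rw [MonoidalCategory.tensorHom_def]; simp [unitors_inv_equal]
  mul_comm (f g : 𝟙_ C ⟶ A) := by
    change (λ_ (𝟙_ C)).inv ≫ (f ⊗ₘ g) ≫ μ = (λ_ (𝟙_ C)).inv ≫ (g ⊗ₘ f) ≫ μ
    conv_lhs => rw [← IsCommMonObj.mul_comm A]
    rw [BraidedCategory.braiding_naturality_assoc, leftUnitor_inv_braiding_assoc, unitors_inv_equal]

variable (R : Type w) [CommRing R] [Linear R C] [MonoidalLinear R C]

instance : Module R (Points A) := inferInstanceAs (Module R (𝟙_ C ⟶ A))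

open MonObj in
noncomputable instance : Algebra R (Points A) :=
  Algebra.ofModule (fun r (f g : 𝟙_ C ⟶ A) => by
    change (λ_ (𝟙_ C)).inv ≫ ((r • f) ⊗ₘ g) ≫ μ = r • ((λ_ (𝟙_ C)).inv ≫ (f ⊗ₘ g) ≫ μ)
    simp [MonoidalCategory.tensorHom_def]) (fun r (f g : 𝟙_ C ⟶ A) => by
    change (λ_ (𝟙_ C)).inv ≫ (f ⊗ₘ (r • g)) ≫ μ = r • ((λ_ (𝟙_ C)).inv ≫ (f ⊗ₘ g) ≫ μ)
    simp [MonoidalCategory.tensorHom_def])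
end
end Points

section SymmetricAlgebra
variable {R : Type w} [CommRing R] {M : Type v} [AddCommGroup M] [Module R M]
open SymmetricAlgebra (ι)

lemma symDer_ext (D E : Derivation R (SymmetricAlgebra R M) (SymmetricAlgebra R M))
    (h : ∀ m, D (ι R M m) = E (ι R M m)) : D = E := by
  ext x
  induction x using SymmetricAlgebra.induction with
  | algebraMap r => simp
  | ι m => exact h m
  | mul a b ha hb => simp [ha, hb]
  | add a b ha hb => simp [ha, hb]

lemma exists_symDer (f : M →ₗ[R] SymmetricAlgebra R M) :
    ∃ D : Derivation R (SymmetricAlgebra R M) (SymmetricAlgebra R M),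
      ∀ m, D (ι R M m) = f m := by
  let φ : SymmetricAlgebra R M →ₐ[R]
      TrivSqZeroExt (SymmetricAlgebra R M) (SymmetricAlgebra R M) := SymmetricAlgebra.lift
    ((TrivSqZeroExt.inlAlgHom R _ _).toLinearMap ∘ₗ ι R M +
      (TrivSqZeroExt.inrHom (SymmetricAlgebra R M) _).restrictScalars R ∘ₗ f)
  have hφ : ∀ a, (φ a).fst = a := by
    intro a
    have : (TrivSqZeroExt.fstHom R _ _).comp φ = AlgHom.id R (SymmetricAlgebra R M) := by
      ext m; simp [φ]
    exact congrArg (fun g => g a) this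
  refine ⟨Derivation.mk' ((TrivSqZeroExt.sndHom (SymmetricAlgebra R M) _).restrictScalars R ∘ₗ
    φ.toLinearMap) ?_, ?_⟩
  · intro a b; simp [hφ, mul_comm]
  · intro m; simp [φ]

/-- A bilinear operation on `M` extends uniquely to a bi-derivation of `S M`. -/
theorem existsUnique_symBracket (l : M →ₗ[R] M →ₗ[R] M) :
    ∃! b : SymmetricAlgebra R M →ₗ[R] SymmetricAlgebra R M →ₗ[R] SymmetricAlgebra R M,
      (∀ F G H, b (F * G) H = F * b G H + G * b F H) ∧
      (∀ F G H, b F (G * H) = G * b F H + b F G * H) ∧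
      ∀ m n, b (ι R M m) (ι R M n) = ι R M (l m n) := by
  choose e he using exists_symDer (R := R) (M := M)
  have hadd : ∀ f g x, e (f + g) x = e f x + e g x := fun f g x =>
    congrArg (fun D => D x) (symDer_ext (e (f + g)) (e f + e g) fun m => by simp [he])
  have hsmul : ∀ (r : R) f x, e (r • f) x = r • e f x := fun r f x =>
    congrArg (fun D => D x) (symDer_ext (e (r • f)) (r • e f) fun m => by simp [he])
  let p : SymmetricAlgebra R M → M →ₗ[R] SymmetricAlgebra R M := fun F =>
    { toFun := fun n => e (ι R M ∘ₗ l.flip n) F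
      map_add' := fun m n => by rw [map_add, LinearMap.comp_add, hadd]
      map_smul' := fun r n => by rw [map_smul, LinearMap.comp_smul, hsmul]; rfl }
  have p1 : ∀ F G, p (F + G) = p F + p G := fun F G => by ext n; simp [p]
  have p2 : ∀ (r : R) F, p (r • F) = r • p F := fun r F => by ext n; simp [p]
  refine existsUnique_of_exists_of_unique ⟨LinearMap.mk₂ R (fun F G => e (p F) G)
    (fun F G H => by rw [p1, hadd]) (fun r F G => by rw [p2, hsmul]) (fun F G H => map_add _ _ _)
    (fun r F G => (e (p F)).map_smul r G), ?_, ?_, ?_⟩ ?_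
  · intro F G H
    refine congrArg (fun D => D H) (symDer_ext (e (p (F * G))) (F • e (p G) + G • e (p F)) ?_)
    intro m; simp [he, p]
  · intro F G H; simp [mul_comm]
  · intro m n; simp [he, p]
  · rintro b b' ⟨h1, h2, h3⟩ ⟨h1', h2', h3'⟩
    have key : ∀ m G, b (ι R M m) G = b' (ι R M m) G := by
      intro m G
      exact congrArg (fun D => D G) (symDer_ext (Derivation.mk' (b (ι R M m)) fun x y => by
        rw [h2, mul_comm (b _ _)]; rfl) (Derivation.mk' (b' (ι R M m)) fun x y => by
        rw [h2', mul_comm (b' _ _)]; rfl) fun n => by simp [h3, h3'])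
    ext F G
    exact congrArg (fun D => D F) (symDer_ext (Derivation.mk' (b.flip G) fun x y => h1 x y G)
      (Derivation.mk' (b'.flip G) fun x y => h1' x y G) fun n => key n G)
end SymmetricAlgebra

section Quiver

/-- A quiver with vertex set `Q₀` and arrow set `Q₁`. -/
structure QuiverOn (Q₀ : Type*) (Q₁ : Type*) where
  source : Q₁ → Q₀
  target : Q₁ → Q₀

variable {Q₀ Q₁ : Type*} (Q : QuiverOn Q₀ Q₁)

/-- The source in the double quiver, whose arrows are `Q₁ ⊕ Q₁`: here `inl a` is the arrow `a`
and `inr a` is its double. -/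
def QuiverOn.src : Q₁ ⊕ Q₁ → Q₀ := Sum.elim Q.source Q.target

/-- The target in the double quiver. -/
def QuiverOn.tgt : Q₁ ⊕ Q₁ → Q₀ := Sum.elim Q.target Q.source

/-- The antisymmetric pairing of arrows of the double quiver. -/
def pairing [DecidableEq Q₁] : Q₁ ⊕ Q₁ → Q₁ ⊕ Q₁ → ℤ
  | .inl a, .inr b => if a = b then 1 else 0
  | .inr a, .inl b => if a = b then -1 else 0
  | _, _ => 0

/-- A cyclic path in the double quiver: a constant path, or a nonempty closed path up to cyclic
permutation. Paths are read from left to right. -/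
inductive CyclicPath : Type _
  | const (i : Q₀) : CyclicPath
  | word (p : Cycle (Q₁ ⊕ Q₁)) (ne : p ≠ Cycle.nil)
      (closed : p.Chain fun a b => Q.tgt a = Q.src b) : CyclicPath

variable (R : Type w) [CommRing R]

/-- The module `𝒩`, free on the cyclic paths of the double quiver. -/
abbrev Necklaces : Type _ := CyclicPath Q →₀ R

/-- The class in `𝒩` of a cyclic word in the arrows; it is zero unless the word is a nonempty
closed path. -/
noncomputable def wordClass (p : Cycle (Q₁ ⊕ Q₁)) : Necklaces Q R :=
  open scoped Classical in
  if h : p ≠ Cycle.nil ∧ p.Chain (fun a b => Q.tgt a = Q.src b) then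
    Finsupp.single (.word p h.1 h.2) 1 else 0

variable [DecidableEq Q₁]

/-- The term `⟨a, b⟩ a u a b v b` of the augmented bracket, for representatives `a u` and `b v` of
two cyclic words. -/
noncomputable def brPlusTerm : List (Q₁ ⊕ Q₁) → List (Q₁ ⊕ Q₁) → Necklaces Q R
  | a :: u, b :: v => pairing a b • wordClass Q R ((a :: u) ++ [a] ++ (b :: v) ++ [b] : List _)
  | _, _ => 0

/-- The augmented bracket of two cyclic paths: the sum of the terms above over all cyclic
rotations of the two words. It vanishes on constant paths. -/
noncomputable def brPlusPath : CyclicPath Q → CyclicPath Q → Necklaces Q R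
  | .word p _ _, .word q _ _ =>
      (p.lists.map fun l => (q.lists.map fun m => brPlusTerm Q R l m).sum).sum
  | _, _ => 0

/-- The augmented necklace bracket on `𝒩`. -/
noncomputable def brPlus : Necklaces Q R →ₗ[R] Necklaces Q R →ₗ[R] Necklaces Q R :=
  Finsupp.linearCombination R fun p => Finsupp.linearCombination R fun q => brPlusPath Q R p q

/-- The free commutative algebra `S𝒩`. -/
abbrev SymNecklaces : Type _ := SymmetricAlgebra R (Necklaces Q R)

/-- The Poisson bracket on `S𝒩`: the bi-derivation that extends the augmented bracket. -/
noncomputable def symBrPlus :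
    SymNecklaces Q R →ₗ[R] SymNecklaces Q R →ₗ[R] SymNecklaces Q R :=
  (existsUnique_symBracket (brPlus Q R)).choose

/-- A cyclic path as a generator of `S𝒩`. -/
noncomputable def pathGen (p : CyclicPath Q) : SymNecklaces Q R :=
  SymmetricAlgebra.ι R (Necklaces Q R) (Finsupp.single p 1)

end Quiver

section Rep
variable {C : Type u} [Category.{v} C] [MonoidalCategory C] [SymmetricCategory C]

/-- Coevaluation in the opposite order, `1 ⟶ cᘁ ⊗ c`. -/
def coevSwap (c : C) [HasRightDual c] : 𝟙_ C ⟶ cᘁ ⊗ c := η_ c cᘁ ≫ (β_ c cᘁ).hom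

/-- Insert a coevaluation strand coloured by `c` to the left of `z`. -/
def cup (c z : C) [HasRightDual c] : z ⟶ cᘁ ⊗ (c ⊗ z) :=
  (λ_ z).inv ≫ coevSwap c ▷ z ≫ (α_ _ _ _).hom

/-- Join two `A`-valued strands along a coevaluation strand coloured by `c`. -/
def glue {A : C} [MonObj A] {x z : C} (c : C) [HasRightDual c] (f : x ⊗ cᘁ ⟶ A) (g : c ⊗ z ⟶ A) :
    x ⊗ z ⟶ A :=
  x ◁ cup c z ≫ (α_ _ _ _).inv ≫ (f ⊗ₘ g) ≫ MonObj.mul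

lemma cup_nat (c : C) [HasRightDual c] {z z' : C} (f : z ⟶ z') :
    f ≫ cup c z' = cup c z ≫ cᘁ ◁ c ◁ f := by
  simp only [cup, Category.assoc]
  rw [← associator_naturality_right, ← whisker_exchange_assoc, ← leftUnitor_inv_naturality_assoc]

lemma cup_tensor (c z w : C) [HasRightDual c] :
    cup c z ▷ w = cup c (z ⊗ w) ≫ cᘁ ◁ (α_ _ _ _).inv ≫ (α_ _ _ _).inv := by
  simp [cup]

lemma glue_assoc {A : C} [MonObj A] {x z : C} (c d : C) [HasRightDual c] [HasRightDual d]
    (f : x ⊗ cᘁ ⟶ A) (g : c ⊗ dᘁ ⟶ A) (h : d ⊗ z ⟶ A) :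
    glue d (glue c f g) h = glue c f (glue d g h) := by
  have h1 : (glue c f g ⊗ₘ h) = (x ◁ cup c dᘁ ≫ (α_ _ _ _).inv) ▷ (d ⊗ z) ≫ ((f ⊗ₘ g) ⊗ₘ h) ≫
      MonObj.mul ▷ A := by
    rw [glue, ← tensorHom_id, ← tensorHom_id, MonoidalCategory.tensorHom_comp_tensorHom,
        MonoidalCategory.tensorHom_comp_tensorHom, Category.id_comp, Category.comp_id]
    simp
  have h2 : (f ⊗ₘ glue d g h) = _ ◁ (c ◁ cup d z ≫ (α_ _ _ _).inv) ≫ (f ⊗ₘ (g ⊗ₘ h)) ≫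
      A ◁ MonObj.mul := by
    rw [glue, ← id_tensorHom (x ⊗ cᘁ), ← id_tensorHom A, MonoidalCategory.tensorHom_comp_tensorHom,
        MonoidalCategory.tensorHom_comp_tensorHom, Category.id_comp, Category.comp_id]
    simp
  have h3 := congrArg (fun k => x ◁ k) (cup_nat c (cup d z))
  simp only [MonoidalCategory.whiskerLeft_comp] at h3
  rw [show glue d (glue c f g) h = x ◁ cup d z ≫ (α_ _ _ _).inv ≫ (glue c f g ⊗ₘ h) ≫
      MonObj.mul from rfl, show glue c f (glue d g h) = x ◁ cup c z ≫ (α_ _ _ _).inv ≫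
      (f ⊗ₘ glue d g h) ≫ MonObj.mul from rfl, h1, h2]
  simp only [Category.assoc, MonObj.mul_assoc, associator_naturality_assoc, comp_whiskerRight,
    whisker_assoc, Iso.inv_hom_id_assoc, cup_tensor, MonoidalCategory.whiskerLeft_comp,
    reassoc_of% h3]
  have h4 : x ◁ (α_ (cᘁ : C) (c ⊗ (dᘁ : C)) (d ⊗ z)).inv ≫ (α_ _ _ _).inv ≫
      (α_ x (cᘁ : C) (c ⊗ (dᘁ : C))).inv ▷ (d ⊗ z) ≫ (α_ _ _ _).hom = (α_ _ _ _).inv := by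
    monoidal
  rw [reassoc_of% h4]
  simp

lemma perm_aux (a b d e : C) :
    (α_ _ _ _).hom ≫ a ◁ (β_ b (d ⊗ e)).hom ≫ a ◁ ((β_ d e).hom ▷ b ≫ (α_ _ _ _).hom) ≫
      (α_ _ _ _).inv ≫ (β_ (a ⊗ e) (d ⊗ b)).hom =
    (β_ (a ⊗ b) (d ⊗ e)).hom ≫ (α_ _ _ _).hom ≫ d ◁ (β_ e (a ⊗ b)).hom ≫
      d ◁ ((β_ a b).hom ▷ e ≫ (α_ _ _ _).hom) ≫ (α_ _ _ _).inv := by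
  simp [BraidedCategory.braiding_tensor_right_hom, BraidedCategory.braiding_tensor_left_hom]
  have c1 : ∀ p q r s : C, p ◁ (β_ q r).hom ▷ s ≫ p ◁ (β_ r q).hom ▷ s = 𝟙 _ := by
    intro p q r s
    rw [← MonoidalCategory.whiskerLeft_comp, ← comp_whiskerRight]; simp
  have c2 : ∀ p q r s : C, p ◁ q ◁ (β_ r s).hom ≫ p ◁ q ◁ (β_ s r).hom = 𝟙 _ := by
    intro p q r s
    rw [← MonoidalCategory.whiskerLeft_comp, ← MonoidalCategory.whiskerLeft_comp]; simp
  have c3 : ∀ x y : C, a ◁ (α_ d x y).inv ≫ (α_ _ _ _).inv ≫ (α_ a d x).inv ▷ y ≫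
      (β_ a d).hom ▷ x ▷ y ≫ (α_ _ _ _).hom ≫ (α_ _ _ _).hom = sw a d (x ⊗ y) := by
    intro x y; simp [sw]
  rw [reassoc_of% c1, reassoc_of% c1, whiskerLeft_inv_hom_assoc, reassoc_of% c2,
    reassoc_of% c3 e b, reassoc_of% sw_nat3, reassoc_of% c2, ← reassoc_of% c3 b e,
    whiskerLeft_hom_inv_assoc]

lemma coev_cup (c d : C) [HasRightDual c] [HasRightDual d] :
    η_ c (cᘁ : C) ≫ c ◁ cup d (cᘁ : C) = (λ_ (𝟙_ C)).inv ≫ (η_ c (cᘁ : C) ⊗ₘ η_ d (dᘁ : C)) ≫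
      (α_ _ _ _).hom ≫ c ◁ (β_ (cᘁ : C) (d ⊗ (dᘁ : C))).hom ≫
      c ◁ ((β_ d (dᘁ : C)).hom ▷ (cᘁ : C) ≫ (α_ _ _ _).hom) := by
  have h1 : cup d (cᘁ : C) = (ρ_ _).inv ≫ (cᘁ : C) ◁ η_ d (dᘁ : C) ≫
      (β_ (cᘁ : C) (d ⊗ (dᘁ : C))).hom ≫ (β_ d (dᘁ : C)).hom ▷ (cᘁ : C) ≫ (α_ _ _ _).hom := by
    rw [BraidedCategory.braiding_naturality_right_assoc, rightUnitor_inv_braiding_assoc, cup,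
      coevSwap, comp_whiskerRight_assoc]
  have h2 : (λ_ (𝟙_ C)).inv ≫ (η_ c (cᘁ : C) ⊗ₘ η_ d (dᘁ : C)) ≫ (α_ _ _ _).hom =
     η_ c (cᘁ : C) ≫ c ◁ ((ρ_ _).inv ≫ (cᘁ : C) ◁ η_ d (dᘁ : C)) := by
    rw [MonoidalCategory.tensorHom_def, unitors_inv_equal]
    simp
  rw [reassoc_of% h2, h1]
  simp

lemma trace_glue {A : C} [MonObj A] [IsCommMonObj A] (c d : C) [HasRightDual c] [HasRightDual d]
    (f : c ⊗ dᘁ ⟶ A) (g : d ⊗ cᘁ ⟶ A) :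
    η_ c (cᘁ : C) ≫ glue d f g = η_ d (dᘁ : C) ≫ glue c g f := by
  have h := perm_aux c cᘁ d dᘁ
  have h1 : (f ⊗ₘ g) ≫ MonObj.mul = (β_ _ _).hom ≫ (g ⊗ₘ f) ≫ MonObj.mul := by
    rw [← BraidedCategory.braiding_naturality_assoc, IsCommMonObj.mul_comm]
  rw [glue, glue, h1, reassoc_of% coev_cup, reassoc_of% coev_cup]
  simp only [Category.assoc, MonoidalCategory.whiskerLeft_comp] at h ⊢
  rw [reassoc_of% h, BraidedCategory.braiding_naturality_assoc]
  simp [unitors_inv_equal]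
variable [TensorCocomplete C] [Preadditive C] [MonoidalPreadditive C]

variable {Q₀ Q₁ : Type*} [Finite Q₁] (Q : QuiverOn Q₀ Q₁)
  (c : Q₀ → C) [∀ i, HasRightDual (c i)]

/-- `h_aᵛ = c_{s(a)} ⊗ c_{t(a)}ᵛ`. -/
abbrev hDualArrow (a : Q₁ ⊕ Q₁) : C := c (Q.src a) ⊗ (c (Q.tgt a))ᘁ

instance hasFiniteBiproducts_of_tensorCocomplete : HasFiniteBiproducts C :=
  HasFiniteBiproducts.of_hasFiniteCoproducts

/-- `hᵛ`, the biproduct of the `h_aᵛ` over all arrows of the double quiver. -/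
noncomputable abbrev hDual : C := ⨁ hDualArrow Q c

/-- The commutative monoid `S hᵛ`. -/
noncomputable abbrev SymHDual : C := Sym (hDual Q c)

/-- The inclusion `h_aᵛ ⟶ hᵛ ⟶ S hᵛ`, as a map on `c_{s(a)} ⊗ c_kᵛ` for a vertex `k` equal to
`t(a)`; it is zero for `k ≠ t(a)`. -/
noncomputable def arrowGen (a : Q₁ ⊕ Q₁) (k : Q₀) : c (Q.src a) ⊗ (c k)ᘁ ⟶ SymHDual Q c :=
  open scoped Classical in
  if h : k = Q.tgt a then
    c (Q.src a) ◁ eqToHom (by rw [h]) ≫ biproduct.ι (hDualArrow Q c) a ≫ Sym.gen (hDual Q c)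
  else 0

/-- The open strand of a path `a l` ending at the vertex `k`: consecutive arrows are joined by
coevaluations and the results are multiplied in `S hᵛ`. -/
noncomputable def strand : (a : Q₁ ⊕ Q₁) → List (Q₁ ⊕ Q₁) → (k : Q₀) →
    (c (Q.src a) ⊗ (c k)ᘁ ⟶ SymHDual Q c)
  | a, [], k => arrowGen Q c a k
  | a, b :: l, k => glue (c (Q.src b)) (arrowGen Q c a (Q.src b)) (strand b l k)

/-- The trace of a word: its strand closed up by a coevaluation. -/
noncomputable def traceWord : List (Q₁ ⊕ Q₁) → Points (SymHDual Q c)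
  | [] => 0
  | a :: l => η_ (c (Q.src a)) (c (Q.src a))ᘁ ≫ strand Q c a l (Q.src a)

lemma strand_snoc (a b : Q₁ ⊕ Q₁) (l : List (Q₁ ⊕ Q₁)) (k : Q₀) :
    strand Q c a (l ++ [b]) k = glue (c (Q.src b)) (strand Q c a l (Q.src b)) (arrowGen Q c b k) := by
  induction l generalizing a with
  | nil => rfl
  | cons d l ih =>
    change glue _ _ (strand Q c d (l ++ [b]) k) = glue _ (glue _ _ _) _
    rw [ih, glue_assoc]

lemma traceWord_rotate (a : Q₁ ⊕ Q₁) (l : List (Q₁ ⊕ Q₁)) :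
    traceWord Q c (a :: l) = traceWord Q c (l ++ [a]) := by
  cases l with
  | nil => rfl
  | cons b l =>
    change η_ _ _ ≫ glue _ _ _ = η_ _ _ ≫ strand Q c b (l ++ [a]) _
    rw [strand_snoc, trace_glue]

lemma traceWord_rotate_n (l : List (Q₁ ⊕ Q₁)) (n : ℕ) :
    traceWord Q c (l.rotate n) = traceWord Q c l := by
  induction n generalizing l with
  | zero => simp
  | succ n ih =>
    cases l with
    | nil => simp
    | cons a l => rw [List.rotate_cons_succ, ih, ← traceWord_rotate]

/-- The trace of a cyclic word. -/
noncomputable def traceCycle (p : Cycle (Q₁ ⊕ Q₁)) : Points (SymHDual Q c) :=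
  Quotient.liftOn p (traceWord Q c) fun l m ⟨n, hn⟩ => by
    subst hn
    exact (traceWord_rotate_n Q c l n).symm

/-- The circle coloured by `c`: coevaluation followed by evaluation. -/
def circle (c : C) [HasRightDual c] : 𝟙_ C ⟶ 𝟙_ C := coevSwap c ≫ ε_ c cᘁ

/-- The trace of a cyclic path. -/
noncomputable def tracePath : CyclicPath Q → Points (SymHDual Q c)
  | .const i => circle (c i) ≫ MonObj.one
  | .word p _ _ => traceCycle Q c p

variable (R : Type w) [CommRing R] [Linear R C] [MonoidalLinear R C]

/-- The algebra map `tr : S𝒩 → C(1, S hᵛ)`. -/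
noncomputable def tr : SymNecklaces Q R →ₐ[R] Points (SymHDual Q c) :=
  SymmetricAlgebra.lift (Finsupp.linearCombination R (tracePath Q c))

/-- The string diagram `h_aᵛ ⊗ h_bᵛ ⟶ h_aᵛ ⊗ h_aᵛ ⊗ h_bᵛ ⊗ h_bᵛ ⟶ S hᵛ` of the augmented bracket,
for arrows `a`, `b` in involution: with `i = s(a)`, `j = s(b)`, it sends `(x ⊗ φ) ⊗ (y ⊗ ψ)` to the
product of `e ⊗ φ`, `x ⊗ f'`, `f ⊗ ψ` and `y ⊗ e'`, where `e ⊗ e'` and `f ⊗ f'` stand for the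
coevaluations of `c_i` and `c_j`. -/
noncomputable def plusDiagram (a b : Q₁ ⊕ Q₁) :
    hDualArrow Q c a ⊗ hDualArrow Q c b ⟶ SymHDual Q c :=
  ((β_ _ _).hom ⊗ₘ ((λ_ _).inv ≫ coevSwap (c (Q.src b)) ▷ _ ≫ _ ◁ (β_ _ _).hom)) ≫
  (λ_ _).inv ≫ η_ (c (Q.src a)) (c (Q.src a))ᘁ ▷ _ ≫ (α_ _ _ _).hom ≫
  c (Q.src a) ◁ (β_ _ _).hom ⊗≫
  (((arrowGen Q c a (Q.tgt a) ⊗ₘ arrowGen Q c a (Q.src b)) ≫ MonObj.mul) ⊗ₘ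
    ((arrowGen Q c b (Q.tgt b) ⊗ₘ arrowGen Q c b (Q.src a)) ≫ MonObj.mul)) ≫ MonObj.mul

end Rep

section Bracket
variable {C : Type u} [Category.{v} C] [MonoidalCategory C] [SymmetricCategory C]
  [TensorCocomplete C] [Preadditive C] [MonoidalPreadditive C]
  {Q₀ Q₁ : Type*} [Fintype Q₁] [DecidableEq Q₁] (Q : QuiverOn Q₀ Q₁)
  (c : Q₀ → C) [∀ i, HasRightDual (c i)]

/-- The map `hᵛ ⊗ hᵛ ⟶ S hᵛ` whose component on `h_aᵛ ⊗ h_bᵛ` is `⟨a, b⟩` times the string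
diagram. -/
noncomputable def plusOnGenerators : hDual Q c ⊗ hDual Q c ⟶ SymHDual Q c :=
  ∑ a, ∑ b, (biproduct.π (hDualArrow Q c) a ⊗ₘ biproduct.π (hDualArrow Q c) b) ≫
    (pairing a b • plusDiagram Q c a b)

/-- The bracket `{-, -}⁺`: the bi-derivation of `S hᵛ` with the given values on generators. -/
noncomputable def poissonPlus : SymHDual Q c ⊗ SymHDual Q c ⟶ SymHDual Q c :=
  (Sym.existsUnique_biderivation (plusOnGenerators Q c)).choose

end Bracket

end NecklaceTrace

open NecklaceTrace

/-! The trace of a closed word is a product of arrow generators in the commutative monoid `S hᵛ`,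
with its indices contracted by coevaluations. A derivation `D` of `S hᵛ` passes through products and
contractions by the Leibniz rule. By the cyclic symmetry of the trace, `D` applied to the n-th arrow
of a word is `D` applied to the first arrow of a rotated word. Hence `D` of a trace is a sum over
all rotations (`traceWord_comp`).

This is used twice: for `{-, tr m}` on `tr l`, and then, for each rotation of `l`, for the
derivation that brackets its first arrow with the argument and keeps its tail as a factor. So `{tr
l, tr m}⁺` becomes a double sum over rotations `a u` of `l` and `b v` of `m` (`op_traceWord`), which
has the shape of the necklace bracket. It remains to see that the term of `a u` and `b v` is `⟨a,
b⟩` times the trace of `a u a b v b` (`traceDer_wordDer`). Up to that scalar, both diagrams consist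
of the same six coevaluations, followed by a permutation of factors and the product of the same six
maps: two copies of `a`, two of `b`, and the two tails. `merge` and `glue_glue_eq` reduce the
comparison to an equality of permutations, and this holds by coherence for symmetric monoidal
categories, `Struct.ext`.

`arrowGen` vanishes at a wrong endpoint, so these identities hold for all words, closed or not.
Closedness matters only when a word is read as a necklace (`chain_bracketWord`). Constant paths have
scalar traces, which derivations kill. Finally, both sides of the theorem are derivations along `tr`
in each variable, so generators suffice (`symAlgHom_der_ext`). Independence of the startpoint is
built into `tr` through `traceCycle`. -/

namespace NecklaceTrace

set_option linter.unusedSectionVars false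

/-! ### Coherence for symmetric monoidal categories, with labelled atoms. -/

section Coherence
variable {C : Type u} [Category.{v} C] [MonoidalCategory C] [SymmetricCategory C]

/-- The right-nested tensor product of a list of labelled objects. -/
abbrev listTensor : List (ℕ × C) → C
  | [] => 𝟙_ C
  | x :: l => x.2 ⊗ listTensor l

/-- `IsExtract x l l' f`: the list `l'` is `l` with `x` inserted, and `f` moves `x` to the front. -/
inductive IsExtract (x : ℕ × C) :
    (l l' : List (ℕ × C)) → (listTensor l' ⟶ x.2 ⊗ listTensor l) → Prop
  | here (l) : IsExtract x l (x :: l) (𝟙 (x.2 ⊗ listTensor l))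
  | there (y : ℕ × C) {l l'} {f : listTensor l' ⟶ x.2 ⊗ listTensor l} :
      IsExtract x l l' f → IsExtract x (y :: l) (y :: l') (y.2 ◁ f ≫ sw y.2 x.2 (listTensor l))

/-- The canonical permutations of the factors of `listTensor`. -/
inductive IsPerm : (l m : List (ℕ × C)) → (listTensor l ⟶ listTensor m) → Prop
  | nil : IsPerm [] [] (𝟙 (𝟙_ C))
  | cons {x : ℕ × C} {l l' m} {f : listTensor l' ⟶ x.2 ⊗ listTensor l}
      {g : listTensor l ⟶ listTensor m} : IsExtract x l l' f → IsPerm l m g →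
      IsPerm l' (x :: m) (f ≫ x.2 ◁ g)

lemma IsExtract.mem {x : ℕ × C} {l l' f} (h : IsExtract x l l' f) : x ∈ l' := by
  induction h <;> simp_all

lemma IsExtract.subset {x : ℕ × C} {l l' f} (h : IsExtract x l l' f) : l.Sublist l' := by
  induction h with
  | here => simp
  | there y h ih => simpa using ih

/-- Distinct entries leave only one position from which `x` can be taken. The remaining lists are
only propositionally equal, hence the `eqToHom`. -/
lemma IsExtract.unique {x : ℕ × C} {l l' f} (h : IsExtract x l l' f) (hn : l'.Nodup) :
    ∀ {m g}, IsExtract x m l' g → ∃ e : l = m, f ≫ eqToHom (by rw [e]) = g := by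
  induction h with
  | here l =>
    intro m g hg
    cases hg with
    | here => exact ⟨rfl, by simp⟩
    | there y h => exact absurd h.mem (List.nodup_cons.1 hn).1
  | there y h ih =>
    intro m g hg
    cases hg with
    | here => exact absurd h.mem (List.nodup_cons.1 hn).1
    | there y h' =>
      obtain ⟨rfl, e⟩ := ih (List.nodup_cons.1 hn).2 h'
      refine ⟨rfl, ?_⟩
      rw [← e]; simp

lemma IsPerm.unique {l m : List (ℕ × C)} {f g} (hf : IsPerm l m f) (hn : l.Nodup)
    (hg : IsPerm l m g) : f = g := by
  induction hf with
  | nil => cases hg; rfl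
  | cons h _ ih =>
    cases hg with
    | cons h' k =>
      obtain ⟨rfl, e⟩ := h.unique hn h'
      rw [ih (hn.sublist h.subset) k, ← e]; simp

lemma IsPerm.id (l : List (ℕ × C)) : IsPerm l l (𝟙 _) := by
  induction l with
  | nil => exact .nil
  | cons x l ih =>
    have := IsPerm.cons (.here (x := x) l) ih
    simpa using this

lemma IsPerm.whiskerLeft (x : ℕ × C) {l m : List (ℕ × C)} {f} (h : IsPerm l m f) :
    IsPerm (x :: l) (x :: m) (x.2 ◁ f) := by
  have := IsPerm.cons (.here (x := x) l) h
  rwa [Category.id_comp] at this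

lemma IsPerm.swap (x y : ℕ × C) (l : List (ℕ × C)) :
    IsPerm (x :: y :: l) (y :: x :: l) (sw x.2 y.2 (listTensor l)) := by
  have := IsPerm.cons (.there x (.here (x := y) l)) (.id (x :: l))
  simpa using this

/-- Two extractions can be made in either order, at the cost of a final swap. The inductive step,
where both pass a common entry `z`, is the Yang–Baxter identity `sw_braid`. -/
lemma IsExtract.exchange {x y : ℕ × C} {l l₁ l₂ f g} (hf : IsExtract y l₁ l f)
    (hg : IsExtract x l₂ l₁ g) : ∃ l₃ f' g', IsExtract x l₃ l f' ∧ IsExtract y l₂ l₃ g' ∧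
      f ≫ y.2 ◁ g ≫ sw _ _ _ = f' ≫ x.2 ◁ g' := by
  induction hf generalizing l₂ with
  | here l => exact ⟨_, _, _, .there y hg, .here _, by simp⟩
  | there z hf ih =>
    cases hg with
    | here => exact ⟨_, _, _, .here _, hf, by simp⟩
    | there z hg =>
      rename_i m _
      obtain ⟨l₃, f', g', h1, h2, h3⟩ := ih hg
      refine ⟨_, _, _, .there z h1, .there z h2, ?_⟩
      have hb := sw_braid z.2 y.2 x.2 (listTensor m)
      simp only [MonoidalCategory.whiskerLeft_comp, Category.assoc]
      rw [← reassoc_of% sw_nat3, hb, ← reassoc_of% sw_nat3]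
      simp only [← MonoidalCategory.whiskerLeft_comp_assoc, h3]

/-- Extracting `x` after a permutation is the same as extracting it before and permuting the rest.
This is what makes canonical permutations closed under composition. -/
lemma IsPerm.extract {x : ℕ × C} {m m' i} (hi : IsExtract x m' m i) :
    ∀ {l f}, IsPerm l m f → ∃ l' j f', IsExtract x l' l j ∧ IsPerm l' m' f' ∧
      f ≫ i = j ≫ x.2 ◁ f' := by
  induction hi with
  | here m =>
    intro l f hf
    cases hf with
    | cons h k => exact ⟨_, _, _, h, k, by simp⟩
  | there y hi ih =>
    intro l f hf
    cases hf with
    | cons h k =>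
      obtain ⟨l', j, f', h1, h2, h3⟩ := ih k
      obtain ⟨l₃, a, b, h4, h5, h6⟩ := h.exchange h1
      refine ⟨_, _, _, h4, .cons h5 h2, ?_⟩
      rw [Category.assoc, ← MonoidalCategory.whiskerLeft_comp_assoc, h3,
        MonoidalCategory.whiskerLeft_comp_assoc, sw_nat3, reassoc_of% h6]
      simp

lemma IsPerm.comp {l m n : List (ℕ × C)} {f g} (hf : IsPerm l m f) (hg : IsPerm m n g) :
    IsPerm l n (f ≫ g) := by
  induction hg generalizing l with
  | nil => simpa using hf
  | cons h k ih =>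
    obtain ⟨l', j, f', h1, h2, h3⟩ := IsPerm.extract h hf
    rw [reassoc_of% h3, ← MonoidalCategory.whiskerLeft_comp]
    exact .cons h1 (ih h2)

/-- A tensor expression with labelled atoms that evaluates to the given object. -/
inductive Rep : C → Type (max u v)
  | atom (n : ℕ) (x : C) : Rep x
  | unit : Rep (𝟙_ C)
  | tensor {x y : C} (X : Rep x) (Y : Rep y) : Rep (x ⊗ y)

namespace Rep

/-- The atoms of an expression, followed by a given list. -/
abbrev leaves : {x : C} → Rep x → List (ℕ × C) → List (ℕ × C)
  | _, atom n x, l => (n, x) :: l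
  | _, unit, l => l
  | _, tensor X Y, l => X.leaves (Y.leaves l)

/-- The rebracketing of an expression, followed by a list. -/
def norm : {x : C} → (X : Rep x) → (l : List (ℕ × C)) →
    (x ⊗ listTensor l ≅ listTensor (X.leaves l))
  | _, atom _ _, _ => Iso.refl _
  | _, unit, l => λ_ (listTensor l)
  | _, tensor (x := x) X Y, l => α_ _ _ _ ≪≫ whiskerLeftIso x (Y.norm l) ≪≫ X.norm (Y.leaves l)

lemma norm_perm {x : C} (X : Rep x) {l m f} (hf : IsPerm l m f) :
    ∃ g, IsPerm (X.leaves l) (X.leaves m) g ∧ x ◁ f ≫ (X.norm m).hom = (X.norm l).hom ≫ g := by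
  induction X generalizing l m f with
  | atom n x => exact ⟨_, hf.whiskerLeft (n, x), by simp [norm]⟩
  | unit => exact ⟨_, hf, by simp [norm]⟩
  | tensor X Y hX hY =>
    obtain ⟨g, h1, h2⟩ := hY hf
    obtain ⟨k, h3, h4⟩ := hX h1
    refine ⟨k, h3, ?_⟩
    rename_i x₁ _
    have e := congrArg (fun t => x₁ ◁ t) h2
    simp only [MonoidalCategory.whiskerLeft_comp] at e
    simp [norm, ← h4, reassoc_of% e]

/-- Induction on `Y`: the hexagon identity `sw_tensor2` moves the atom past one tensor factor at a
time. In `norm_swap` the other hexagon, `sw_tensor1`, does the same for a composite left factor. -/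
lemma norm_swap_atom (n : ℕ) (x : C) {y : C} (Y : Rep y) (l) :
    ∃ f, IsPerm ((n, x) :: Y.leaves l) (Y.leaves ((n, x) :: l)) f ∧
      sw x y (listTensor l) ≫ (Y.norm ((n, x) :: l)).hom = x ◁ (Y.norm l).hom ≫ f := by
  induction Y generalizing l with
  | atom m y => exact ⟨_, .swap (n, x) (m, y) l, by simp [norm]⟩
  | unit => exact ⟨_, .id _, by simp [norm, sw_unit2, listTensor]⟩
  | tensor Y Z hY hZ =>
    rename_i y z
    obtain ⟨f, h1, h2⟩ := hZ l
    obtain ⟨g, h3, h4⟩ := hY (Z.leaves l)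
    obtain ⟨k, h5, h6⟩ := Y.norm_perm h1
    refine ⟨_, h3.comp h5, ?_⟩
    have h := sw_tensor2 x y z (listTensor l)
    have e : (norm (tensor Y Z) ((n, x) :: l)).hom = (α_ y z (x ⊗ listTensor l)).hom ≫
      y ◁ (Z.norm ((n, x) :: l)).hom ≫ (Y.norm _).hom := rfl
    have e' : (norm (tensor Y Z) l).hom = (α_ y z (listTensor l)).hom ≫
      y ◁ (Z.norm l).hom ≫ (Y.norm _).hom := rfl
    rw [e, e', ← reassoc_of% h, ← MonoidalCategory.whiskerLeft_comp_assoc, h2,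
      MonoidalCategory.whiskerLeft_comp_assoc, h6, ← reassoc_of% sw_nat3]
    change _ ≫ _ ≫ sw x y _ ≫ _ = _
    erw [reassoc_of% h4]
    simp

lemma norm_swap {x y : C} (X : Rep x) (Y : Rep y) (l) :
    ∃ f, IsPerm (X.leaves (Y.leaves l)) (Y.leaves (X.leaves l)) f ∧
      sw x y (listTensor l) ≫ y ◁ (X.norm l).hom ≫ (Y.norm _).hom =
        x ◁ (Y.norm l).hom ≫ (X.norm _).hom ≫ f := by
  induction X generalizing l with
  | atom n x =>
    obtain ⟨f, h1, h2⟩ := norm_swap_atom n x Y l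
    refine ⟨f, h1, ?_⟩
    simpa [norm] using h2
  | unit => exact ⟨_, .id _, by simp [norm, sw_unit1]⟩
  | tensor X Z hX hZ =>
    rename_i x z
    obtain ⟨f, h1, h2⟩ := hZ l
    obtain ⟨g, h3, h4⟩ := hX (Z.leaves l)
    obtain ⟨k, h5, h6⟩ := X.norm_perm h1
    refine ⟨_, h5.comp h3, ?_⟩
    have h := sw_tensor1 x z y (listTensor l)
    have e : ∀ l, (norm (tensor X Z) l).hom = (α_ x z (listTensor l)).hom ≫
      x ◁ (Z.norm l).hom ≫ (X.norm _).hom := fun _ => rfl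
    rw [e, e, MonoidalCategory.whiskerLeft_comp, MonoidalCategory.whiskerLeft_comp]
    simp only [Category.assoc]
    rw [← reassoc_of% h, ← reassoc_of% sw_nat3, h4, ← MonoidalCategory.whiskerLeft_comp_assoc,
      ← MonoidalCategory.whiskerLeft_comp_assoc, Category.assoc, h2]
    simp [reassoc_of% h6]

end Rep

/-- The structural morphisms between tensor expressions. -/
inductive Struct : {x y : C} → Rep x → Rep y → (x ⟶ y) → Prop
  | comp {x y z : C} {X : Rep x} {Y : Rep y} {Z : Rep z} {f g} :
      Struct X Y f → Struct Y Z g → Struct X Z (f ≫ g)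
  | id {x : C} (X : Rep x) : Struct X X (𝟙 x)
  | whiskerLeft {x y z : C} (X : Rep x) {Y : Rep y} {Z : Rep z} {f} :
      Struct Y Z f → Struct (X.tensor Y) (X.tensor Z) (x ◁ f)
  | whiskerRight {x y z : C} {Y : Rep y} {Z : Rep z} (X : Rep x) {f} :
      Struct Y Z f → Struct (Y.tensor X) (Z.tensor X) (f ▷ x)
  | assoc {x y z : C} (X : Rep x) (Y : Rep y) (Z : Rep z) :
      Struct ((X.tensor Y).tensor Z) (X.tensor (Y.tensor Z)) (α_ x y z).hom
  | assoc_inv {x y z : C} (X : Rep x) (Y : Rep y) (Z : Rep z) :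
      Struct (X.tensor (Y.tensor Z)) ((X.tensor Y).tensor Z) (α_ x y z).inv
  | left {x : C} (X : Rep x) : Struct (Rep.unit.tensor X) X (λ_ x).hom
  | left_inv {x : C} (X : Rep x) : Struct X (Rep.unit.tensor X) (λ_ x).inv
  | right {x : C} (X : Rep x) : Struct (X.tensor .unit) X (ρ_ x).hom
  | right_inv {x : C} (X : Rep x) : Struct X (X.tensor .unit) (ρ_ x).inv
  | braid {x y : C} (X : Rep x) (Y : Rep y) : Struct (X.tensor Y) (Y.tensor X) (β_ x y).hom

namespace Struct

lemma tensorHom {x y z w : C} {X : Rep x} {Y : Rep y} {Z : Rep z} {W : Rep w} {f g}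
    (hf : Struct X Y f) (hg : Struct Z W g) : Struct (X.tensor Z) (Y.tensor W) (f ⊗ₘ g) := by
  rw [MonoidalCategory.tensorHom_def]
  exact .comp (.whiskerRight _ hf) (.whiskerLeft _ hg)

lemma sw {x y z : C} (X : Rep x) (Y : Rep y) (Z : Rep z) :
    Struct (X.tensor (Y.tensor Z)) (Y.tensor (X.tensor Z)) (sw x y z) :=
  .comp (.assoc_inv _ _ _) (.comp (.whiskerRight _ (.braid _ _)) (.assoc _ _ _))

/-- Rebracketing turns every structural morphism into a canonical permutation of the atoms. The
appended list `l` is needed for the induction, because a left tensor factor is normalised in front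
of the atoms of the right one. -/
lemma exists_perm {x y : C} {X : Rep x} {Y : Rep y} {f} (h : Struct X Y f) (l) :
    ∃ g, IsPerm (X.leaves l) (Y.leaves l) g ∧
      f ▷ listTensor l ≫ (Y.norm l).hom = (X.norm l).hom ≫ g := by
  induction h generalizing l with
  | comp _ _ h k =>
    obtain ⟨f, h1, h2⟩ := h l
    obtain ⟨g, h3, h4⟩ := k l
    exact ⟨_, h1.comp h3, by rw [comp_whiskerRight_assoc, h4, reassoc_of% h2]⟩
  | id X => exact ⟨_, .id _, by simp⟩
  | whiskerLeft X _ h =>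
    obtain ⟨f, h1, h2⟩ := h l
    obtain ⟨g, h3, h4⟩ := X.norm_perm h1
    refine ⟨_, h3, ?_⟩
    rename_i x₁ _ _ _ _ _ _
    have e := congrArg (fun t => x₁ ◁ t) h2
    simp only [MonoidalCategory.whiskerLeft_comp] at e
    simp [Rep.norm, ← h4, reassoc_of% e]
  | whiskerRight X _ h =>
    obtain ⟨f, h1, h2⟩ := h (X.leaves l)
    refine ⟨f, h1, ?_⟩
    simp [Rep.norm, ← h2, whisker_exchange_assoc]
  -- Associators and unitors do not change the list of atoms, so their permutation is the identity.
  | assoc | assoc_inv | left | left_inv | right | right_inv =>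
    exact ⟨_, .id _, by simp [Rep.norm, Rep.leaves]⟩
  | braid X Y =>
    obtain ⟨f, h1, h2⟩ := X.norm_swap Y l
    refine ⟨f, h1, ?_⟩
    simp [Rep.norm, ← h2, NecklaceTrace.sw]

/-- Coherence: structural morphisms between expressions with distinct labels agree. -/
theorem ext {x y : C} {X : Rep x} {Y : Rep y} {f g : x ⟶ y} (hf : Struct X Y f)
    (hg : Struct X Y g) (hn : ((X.leaves []).map Prod.fst).Nodup) : f = g := by
  obtain ⟨p, h1, h2⟩ := hf.exists_perm []
  obtain ⟨q, h3, h4⟩ := hg.exists_perm []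
  rw [h1.unique hn.of_map h3, ← h4, cancel_mono] at h2
  -- The appended list is empty, so `h2` compares `f ▷ 𝟙_ C` with `g ▷ 𝟙_ C`; the right unitor
  -- removes the extra unit.
  have h5 : (ρ_ x).hom ≫ f = (ρ_ x).hom ≫ g := by
    rw [← rightUnitor_naturality, ← rightUnitor_naturality]
    exact congrArg (· ≫ (ρ_ y).hom) h2
  exact (cancel_epi _).1 h5

end Struct
end Coherence

/-! ### External products and insertion of points: a normal form for string diagrams. -/

section Insert
variable {C : Type u} [Category.{v} C] [MonoidalCategory C]

/-- The external product of two `A`-valued maps. -/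
def conv {A : C} [MonObj A] {x y : C} (f : x ⟶ A) (g : y ⟶ A) : x ⊗ y ⟶ A :=
  (f ⊗ₘ g) ≫ MonObj.mul

/-- Insert a point of `V` to the left. -/
def ins {V Z W : C} (ω : 𝟙_ C ⟶ V) (g : V ⊗ Z ⟶ W) : Z ⟶ W := (λ_ Z).inv ≫ ω ▷ Z ≫ g

section Conv
variable {A : C} [MonObj A]

lemma conv_assoc {x y z : C} (f : x ⟶ A) (g : y ⟶ A) (h : z ⟶ A) :
    conv (conv f g) h = (α_ x y z).hom ≫ conv f (conv g h) := by
  have h1 : ((f ⊗ₘ g) ≫ MonObj.mul) ⊗ₘ h = ((f ⊗ₘ g) ⊗ₘ h) ≫ MonObj.mul ▷ A := by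
    rw [← tensorHom_id, MonoidalCategory.tensorHom_comp_tensorHom, Category.comp_id]
  have h2 : f ⊗ₘ ((g ⊗ₘ h) ≫ MonObj.mul) = (f ⊗ₘ (g ⊗ₘ h)) ≫ A ◁ MonObj.mul := by
    rw [← id_tensorHom, MonoidalCategory.tensorHom_comp_tensorHom, Category.comp_id]
  simp only [conv, h1, h2, Category.assoc, MonObj.mul_assoc, associator_naturality_assoc]

lemma conv_assoc' {x y z : C} (f : x ⟶ A) (g : y ⟶ A) (h : z ⟶ A) :
    conv f (conv g h) = (α_ x y z).inv ≫ conv (conv f g) h := by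
  rw [conv_assoc, Iso.inv_hom_id_assoc]

lemma comp_conv {x x' y y' : C} (h : x' ⟶ x) (k : y' ⟶ y) (f : x ⟶ A) (g : y ⟶ A) :
    conv (h ≫ f) (k ≫ g) = (h ⊗ₘ k) ≫ conv f g := by
  simp [conv]

lemma comp_conv_left {x x' y : C} (h : x' ⟶ x) (f : x ⟶ A) (g : y ⟶ A) :
    conv (h ≫ f) g = h ▷ y ≫ conv f g := by
  simpa using comp_conv h (𝟙 y) f g

lemma comp_conv_right {x y y' : C} (k : y' ⟶ y) (f : x ⟶ A) (g : y ⟶ A) :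
    conv f (k ≫ g) = x ◁ k ≫ conv f g := by
  simpa using comp_conv (𝟙 x) k f g

lemma whiskerLeft_mul {y : C} (g : y ⟶ A) : A ◁ g ≫ MonObj.mul = conv (𝟙 A) g := by
  simp [conv]

lemma whiskerRight_mul {y : C} (g : y ⟶ A) : g ▷ A ≫ MonObj.mul = conv g (𝟙 A) := by
  simp [conv]

lemma add_conv [Preadditive C] [MonoidalPreadditive C] {x y : C} (f g : x ⟶ A) (h : y ⟶ A) :
    conv (f + g) h = conv f h + conv g h := by
  simp [conv, MonoidalPreadditive.add_tensor]

variable [SymmetricCategory C] [IsCommMonObj A]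

lemma conv_comm {x y : C} (f : x ⟶ A) (g : y ⟶ A) : conv f g = (β_ x y).hom ≫ conv g f := by
  rw [conv, conv, ← BraidedCategory.braiding_naturality_assoc, IsCommMonObj.mul_comm]

lemma conv_left_comm {x y z : C} (f : x ⟶ A) (g : y ⟶ A) (h : z ⟶ A) :
    conv f (conv g h) = sw x y z ≫ conv g (conv f h) := by
  rw [conv_assoc', conv_comm f g, comp_conv_left, conv_assoc]
  simp [sw]

lemma conv_right_comm {x y z : C} (f : x ⟶ A) (g : y ⟶ A) (h : z ⟶ A) :
    conv (conv f g) h = ((α_ x y z).hom ≫ x ◁ (β_ y z).hom ≫ (α_ x z y).inv) ≫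
      conv (conv f h) g := by
  rw [conv_assoc, conv_comm g h, comp_conv_right, conv_assoc']
  simp

lemma conv_conv_comm {x y z w : C} (f : x ⟶ A) (g : y ⟶ A) (h : z ⟶ A) (k : w ⟶ A) :
    conv (conv f g) (conv h k) = ((α_ x y _).hom ≫ x ◁ sw y z w ≫ (α_ x z _).inv) ≫
      conv (conv f h) (conv g k) := by
  rw [conv_assoc, conv_left_comm g, comp_conv_right, conv_assoc']
  simp

end Conv

section Ins
variable {V Z W : C} (ω : 𝟙_ C ⟶ V) (g : V ⊗ Z ⟶ W)

lemma ins_comp {W' : C} (h : W ⟶ W') : ins ω g ≫ h = ins ω (g ≫ h) := by simp [ins]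

lemma comp_ins {Z' : C} (h : Z' ⟶ Z) : h ≫ ins ω g = ins ω (V ◁ h ≫ g) := by
  rw [ins, ins, ← whisker_exchange_assoc, leftUnitor_inv_naturality_assoc]

lemma ins_whiskerRight (a : C) : ins ω g ▷ a = ins ω ((α_ _ _ _).inv ≫ g ▷ a) := by simp [ins]

lemma ins_pre {V' : C} (h : V ⟶ V') (g : V' ⊗ Z ⟶ W) : ins (ω ≫ h) g = ins ω (h ▷ Z ≫ g) := by
  simp [ins]

lemma comp_eq_ins (h : V ⟶ W) : ω ≫ h = ins ω ((ρ_ V).hom ≫ h) := by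
  simp [ins, unitors_inv_equal]

lemma ins_add [Preadditive C] (g h : V ⊗ Z ⟶ W) : ins ω (g + h) = ins ω g + ins ω h := by
  simp [ins]

lemma ins_conv {A y : C} [MonObj A] (g : V ⊗ Z ⟶ A) (h : y ⟶ A) :
    conv (ins ω g) h = ins ω ((α_ _ _ _).inv ≫ conv g h) := by
  rw [ins, comp_conv_left, comp_conv_left]
  simp [ins]

variable [SymmetricCategory C]

lemma whiskerLeft_ins (a : C) : a ◁ ins ω g = ins ω (sw V a Z ≫ a ◁ g) := by
  have := sw_nat1 ω a Z
  rw [ins, ins, reassoc_of% this, sw_unit1]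
  simp

lemma conv_ins {A y : C} [MonObj A] (g : V ⊗ Z ⟶ A) (h : y ⟶ A) :
    conv h (ins ω g) = ins ω (sw V y Z ≫ conv h g) := by
  have := whiskerLeft_ins ω (𝟙 (V ⊗ Z)) y
  have e : ins ω g = ins ω (𝟙 (V ⊗ Z)) ≫ g := by rw [ins_comp, Category.id_comp]
  rw [e, comp_conv_right, this, ins_comp]
  simp

lemma tensorHom_ins {y y' : C} (h : y ⟶ y') : h ⊗ₘ ins ω g = ins ω (sw V y Z ≫ (h ⊗ₘ g)) := by
  rw [MonoidalCategory.tensorHom_def', whiskerLeft_ins, ins_comp, MonoidalCategory.tensorHom_def',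
    Category.assoc]

/-- Brings the coevaluations of two diagrams into a common order, so that only permutations remain
to be compared. -/
lemma ins_swap {V' : C} (ω' : 𝟙_ C ⟶ V') (g : V' ⊗ (V ⊗ Z) ⟶ W) :
    ins ω (ins ω' g) = ins ω' (ins ω (sw V V' Z ≫ g)) := by
  have h : ins ω (ins ω' g) = ins ω (𝟙 _) ≫ ins ω' g := by rw [ins_comp, Category.id_comp]
  rw [h, comp_ins, whiskerLeft_ins, ins_comp]
  simp

end Ins

/-! ### Gluing, the augmented bracket and closed traces in normal form. -/

section Glue
variable [SymmetricCategory C]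

/-- The permutation that joins two strands with labels `x ⊗ d` and `c ⊗ z`. -/
def gluePerm (x c d z : C) : (c ⊗ d) ⊗ (x ⊗ z) ⟶ (x ⊗ d) ⊗ (c ⊗ z) :=
  sw (c ⊗ d) x z ≫ x ◁ ((β_ c d).hom ▷ z ≫ (α_ d c z).hom) ≫ (α_ x d (c ⊗ z)).inv

lemma gluePerm_struct {x c d z : C} (X : Rep x) (K : Rep c) (D : Rep d) (Z : Rep z) :
    Struct ((K.tensor D).tensor (X.tensor Z)) ((X.tensor D).tensor (K.tensor Z))
      (gluePerm x c d z) := by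
  unfold gluePerm
  repeat' first | apply Struct.sw | constructor

lemma cup_eq_ins (c z : C) [HasRightDual c] :
    cup c z = ins (η_ c cᘁ) ((β_ c cᘁ).hom ▷ z ≫ (α_ cᘁ c z).hom) := by
  simp [cup, coevSwap, ins]

lemma glue_eq_ins {A : C} [MonObj A] {x z : C} (c : C) [HasRightDual c] (f : x ⊗ cᘁ ⟶ A)
    (g : c ⊗ z ⟶ A) : glue c f g = ins (η_ c cᘁ) (gluePerm x c cᘁ z ≫ conv f g) := by
  rw [glue, cup_eq_ins, whiskerLeft_ins, ins_comp, gluePerm, conv]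
  simp only [Category.assoc]

/-- The permutation of the augmented bracket. -/
def plusPerm (i i' j j' k l : C) : (i ⊗ i') ⊗ ((j ⊗ j') ⊗ ((i ⊗ k) ⊗ (j ⊗ l))) ⟶
    ((i ⊗ k) ⊗ (i ⊗ j')) ⊗ ((j ⊗ l) ⊗ (j ⊗ i')) :=
  (i ⊗ i') ◁ (sw (j ⊗ j') (i ⊗ k) (j ⊗ l) ≫
    ((β_ i k).hom ⊗ₘ ((β_ j j').hom ▷ (j ⊗ l) ≫ (j' ⊗ j) ◁ (β_ j l).hom))) ≫
  (α_ i i' _).hom ≫ i ◁ (β_ i' _).hom ⊗≫ 𝟙 _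

/-- The objects `i` and `j` each occur twice, once from a coevaluation and once from an arrow. The
separate expressions `I`, `I₂` and `J`, `J₂` record which copy goes where. -/
lemma plusPerm_struct {i i' j j' k l : C} (I : Rep i) (I' : Rep i') (J : Rep j) (J' : Rep j')
    (K : Rep k) (L : Rep l) (I₂ : Rep i) (J₂ : Rep j) :
    Struct ((I.tensor I').tensor ((J.tensor J').tensor ((I₂.tensor K).tensor (J₂.tensor L))))
      (((I.tensor K).tensor (I₂.tensor J')).tensor ((J.tensor L).tensor (J₂.tensor I')))
      (plusPerm i i' j j' k l) := by
  simp [plusPerm, monoidalComp]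
  repeat' first | apply Struct.sw | apply Struct.tensorHom | constructor

/-- The left side is the shape of `plusDiagram` with arbitrary points in place of the coevaluations
and arbitrary maps in place of the arrow generators. -/
lemma ins_convPlus {A : C} [MonObj A] {i i' j j' k l : C} (ω₁ : 𝟙_ C ⟶ i ⊗ i')
  (ω₂ : 𝟙_ C ⟶ j ⊗ j') (f₁ : i ⊗ k ⟶ A) (f₂ : i ⊗ j' ⟶ A) (g₁ : j ⊗ l ⟶ A) (g₂ : j ⊗ i' ⟶ A) :
  ((β_ _ _).hom ⊗ₘ ((λ_ _).inv ≫ (ω₂ ≫ (β_ _ _).hom) ▷ _ ≫ _ ◁ (β_ _ _).hom)) ≫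
  (λ_ _).inv ≫ ω₁ ▷ _ ≫ (α_ _ _ _).hom ≫
  i ◁ (β_ _ _).hom ⊗≫
  (((f₁ ⊗ₘ f₂) ≫ MonObj.mul) ⊗ₘ
    ((g₁ ⊗ₘ g₂) ≫ MonObj.mul)) ≫ MonObj.mul =
   ins ω₂ (ins ω₁ (plusPerm i i' j j' k l ≫ conv (conv f₁ f₂) (conv g₁ g₂))) := by
  have h : (λ_ (j ⊗ l)).inv ≫ (ω₂ ≫ (β_ j j').hom) ▷ (j ⊗ l) ≫ (j' ⊗ j) ◁ (β_ j l).hom =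
    ins ω₂ ((β_ j j').hom ▷ (j ⊗ l) ≫ (j' ⊗ j) ◁ (β_ j l).hom) := by simp [ins]
  rw [h, tensorHom_ins, ins_comp, plusPerm]
  simp only [Category.assoc]
  have h' : ∀ {z w : C} (K : (i ⊗ i') ⊗ z ⟶ w), (λ_ z).inv ≫ ω₁ ▷ z ≫ K = ins ω₁ K := fun _ => rfl
  rw [h', comp_ins, comp_ins]
  simp [monoidalComp, conv]

/-- The point of `(i ⊗ k') ⊗ (k ⊗ i')` that closes up two strands. -/
def closing {i i' k k' : C} (ω : 𝟙_ C ⟶ i ⊗ i') (ω' : 𝟙_ C ⟶ k ⊗ k') :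
    𝟙_ C ⟶ (i ⊗ k') ⊗ (k ⊗ i') :=
  ω ≫ ins ω' (gluePerm i k k' i')

lemma coev_glue {A : C} [MonObj A] (i k : C) [HasRightDual i] [HasRightDual k] (f : i ⊗ kᘁ ⟶ A)
    (g : k ⊗ iᘁ ⟶ A) :
    η_ i iᘁ ≫ glue k f g = closing (η_ i iᘁ) (η_ k kᘁ) ≫ conv f g := by
  rw [glue_eq_ins, closing, Category.assoc, ins_comp]

/-- The exchange of the last two factors. -/
def rs (x y z : C) : (x ⊗ y) ⊗ z ⟶ (x ⊗ z) ⊗ y :=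
  (α_ x y z).hom ≫ x ◁ (β_ y z).hom ≫ (α_ x z y).inv

lemma rs_struct {x y z : C} (X : Rep x) (Y : Rep y) (Z : Rep z) :
    Struct ((X.tensor Y).tensor Z) ((X.tensor Z).tensor Y) (rs x y z) := by
  unfold rs
  repeat' constructor

section Half
variable {A : C} [MonObj A] [IsCommMonObj A]

/-- Isolates the tail `p` of a strand `a u a`. The closing point feeds `p` and leaves a slot of type
`i ⊗ kᘁ` where the first arrow of the closed word stood; the two copies of `a` share this slot. It
is the form in which `bracketLeg` acts on a first arrow. -/
lemma glue_glue_eq (i k : C) {e f' : C} [HasRightDual i] [HasRightDual k] (f₁ : e ⊗ kᘁ ⟶ A)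
    (p : k ⊗ iᘁ ⟶ A) (f₂ : i ⊗ f' ⟶ A) :
    glue i (glue k f₁ p) f₂ = ins (closing (η_ i iᘁ) (η_ k kᘁ))
      (rs _ _ _ ≫ conv (gluePerm e i (kᘁ) f' ≫ conv f₁ f₂) p) := by
  rw [closing, ins_pre, ins_whiskerRight]
  simp only [glue_eq_ins, ins_comp, ins_conv, comp_ins, comp_conv_left, Category.assoc]
  rw [conv_right_comm f₁ p f₂]
  congr 2
  simp only [← Category.assoc]
  congr 1
  refine Struct.ext (X := ((Rep.atom 0 k).tensor (.atom 1 kᘁ)).tensor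
    (((Rep.atom 2 i).tensor (.atom 3 iᘁ)).tensor ((Rep.atom 4 e).tensor (.atom 5 f'))))
    (Y := (((Rep.atom 4 e).tensor (.atom 1 kᘁ)).tensor ((Rep.atom 2 i).tensor (.atom 5 f'))).tensor
      ((Rep.atom 0 k).tensor (.atom 3 iᘁ))) ?_ ?_ (show List.Nodup [0, 1, 2, 3, 4, 5] by decide) <;>
  repeat' first | apply gluePerm_struct | apply rs_struct | constructor

end Half

/-- The heart of the computation. On the left, the augmented bracket is inserted between two closed
words with tails `P` and `Q`; on the right, the halves `a u a` and `b v b` are joined into one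
closed word. The points and the six factors are the same, and only their arrangement differs. -/
lemma merge {A : C} [MonObj A] [IsCommMonObj A] {i i' j j' k l p q : C} (ω₁ : 𝟙_ C ⟶ i ⊗ i')
    (ω₂ : 𝟙_ C ⟶ j ⊗ j') (ω₃ : 𝟙_ C ⟶ (i ⊗ k) ⊗ p) (ω₄ : 𝟙_ C ⟶ (j ⊗ l) ⊗ q)
    (f₁ : i ⊗ k ⟶ A) (f₂ : i ⊗ j' ⟶ A) (g₁ : j ⊗ l ⟶ A) (g₂ : j ⊗ i' ⟶ A)
    (P : p ⟶ A) (Q : q ⟶ A) :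
    ω₄ ≫ conv (ins ω₃ (rs _ _ _ ≫ conv (ins ω₂ (ins ω₁ (plusPerm i i' j j' k l ≫
      conv (conv f₁ f₂) (conv g₁ g₂)))) P)) Q =
    closing ω₁ ω₂ ≫ conv (ins ω₃ (rs _ _ _ ≫ conv (gluePerm i i k j' ≫ conv f₁ f₂) P))
      (ins ω₄ (rs _ _ _ ≫ conv (gluePerm j j l i' ≫ conv g₁ g₂) Q)) := by
  rw [closing, Category.assoc, ins_comp, comp_eq_ins, comp_eq_ins]
  simp only [ins_conv, conv_ins, comp_ins, comp_conv_left, comp_conv_right]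
  -- Five swaps reorder the insertions on the right to `ω₄`, `ω₃`, `ω₂`, `ω₁` from outside to
  -- inside, which is their order on the left.
  rw [ins_swap ω₂ ω₄, ins_swap ω₁ ω₄]
  simp only [comp_ins]
  rw [ins_swap ω₂ ω₃, ins_swap ω₁ ω₃]
  simp only [comp_ins]
  rw [ins_swap ω₁ ω₂, conv_assoc, conv_conv_comm (conv f₁ f₂) (conv g₁ g₂) P Q]
  congr 4
  simp only [← Category.assoc]
  congr 1
  -- The innermost point comes first in the source; the final `.unit` is the source `𝟙_ C` of the
  -- whole diagram.
  refine Struct.ext (X := ((Rep.atom 0 i).tensor (.atom 1 i')).tensor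
    (((Rep.atom 2 j).tensor (.atom 3 j')).tensor
    ((((Rep.atom 4 i).tensor (.atom 5 k)).tensor (.atom 6 p)).tensor
    ((((Rep.atom 7 j).tensor (.atom 8 l)).tensor (.atom 9 q)).tensor .unit))))
    (Y := ((((Rep.atom 0 i).tensor (.atom 5 k)).tensor ((Rep.atom 4 i).tensor (.atom 3 j'))).tensor
      (.atom 6 p)).tensor ((((Rep.atom 2 j).tensor (.atom 8 l)).tensor
      ((Rep.atom 7 j).tensor (.atom 1 i'))).tensor (.atom 9 q))) ?_ ?_
    (show List.Nodup [0, 1, 2, 3, 4, 5, 6, 7, 8, 9] by decide) <;>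
  repeat' first | apply gluePerm_struct | apply rs_struct | apply plusPerm_struct |
    apply Struct.sw | constructor

end Glue
end Insert

/-! ### Derivations obtained from a bi-derivation by fixing one argument. -/

section Derivations
variable {C : Type u} [Category.{v} C] [MonoidalCategory C] [SymmetricCategory C]
  [Preadditive C] [MonoidalPreadditive C] {A : C} [MonObj A] [IsCommMonObj A]

/-- A derivation of a commutative monoid in `C`. -/
def IsDerivation (D : A ⟶ A) : Prop :=
  MonObj.mul ≫ D = conv (𝟙 A) D + conv D (𝟙 A)

lemma IsDerivation.conv_comp {D : A ⟶ A} (hD : IsDerivation D) {x y : C} (f : x ⟶ A)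
    (g : y ⟶ A) : conv f g ≫ D = conv (f ≫ D) g + conv f (g ≫ D) := by
  have h1 : conv (f ≫ D) g = (f ⊗ₘ g) ≫ conv D (𝟙 A) := by
    rw [← comp_conv, Category.comp_id]
  have h2 : conv f (g ≫ D) = (f ⊗ₘ g) ≫ conv (𝟙 A) D := by
    rw [← comp_conv, Category.comp_id]
  rw [h1, h2, ← Preadditive.comp_add, add_comm, ← hD, conv, Category.assoc]

lemma IsDerivation.glue_comp {D : A ⟶ A} (hD : IsDerivation D) {x z : C} (c : C) [HasRightDual c]
    (f : x ⊗ cᘁ ⟶ A) (g : c ⊗ z ⟶ A) :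
    glue c f g ≫ D = glue c (f ≫ D) g + glue c f (g ≫ D) := by
  simp only [glue_eq_ins, ins_comp, Category.assoc, hD.conv_comp, Preadditive.comp_add, ins_add]

/-- Bracketing with a fixed point on the right. -/
def bracketPoint (B : A ⊗ A ⟶ A) (z : 𝟙_ C ⟶ A) : A ⟶ A := (ρ_ A).inv ≫ A ◁ z ≫ B

lemma op_eq (B : A ⊗ A ⟶ A) (f z : 𝟙_ C ⟶ A) :
    Points.op B f z = f ≫ bracketPoint B z := by
  simp [Points.op, bracketPoint, MonoidalCategory.tensorHom_def, unitors_inv_equal]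
  rfl

variable {B : A ⊗ A ⟶ A}

lemma isDerivation_bracketPoint (hB : Sym.IsBiderivation B) (z : 𝟙_ C ⟶ A) : IsDerivation (bracketPoint B z) := by
  have e : MonObj.mul ≫ bracketPoint B z = (ρ_ _).inv ≫ (A ⊗ A) ◁ z ≫ MonObj.mul ▷ A ≫ B := by
    rw [bracketPoint, rightUnitor_inv_naturality_assoc, ← whisker_exchange_assoc]
  have h1 : (ρ_ (A ⊗ A)).inv ≫ (A ⊗ A) ◁ z ≫ (α_ A A A).hom ≫ A ◁ B ≫ MonObj.mul =
      conv (𝟙 A) (bracketPoint B z) := by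
    rw [← whiskerLeft_mul, bracketPoint]
    simp
  -- The second Leibniz term is the first one precomposed with the braiding; commutativity of the
  -- product turns this into the exchange of the two factors.
  have h2 : (ρ_ (A ⊗ A)).inv ≫ (A ⊗ A) ◁ z ≫ (α_ A A A).hom ≫ sw A A A ≫ A ◁ B ≫ MonObj.mul =
      conv (bracketPoint B z) (𝟙 A) := by
    have h3 : (A ⊗ A) ◁ z ≫ (α_ A A A).hom ≫ sw A A A =
        (β_ A A).hom ▷ _ ≫ (A ⊗ A) ◁ z ≫ (α_ A A A).hom := by
      rw [← whisker_exchange_assoc]; simp [sw]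
    rw [reassoc_of% h3, ← rightUnitor_inv_naturality_assoc, h1, ← conv_comm]
  rw [IsDerivation, e, hB.left]
  simp only [Preadditive.comp_add, h1, h2]

/-- The endomorphism of `A` that brackets the `X`-leg of a point of `X ⊗ W`. -/
def bracketLeg {X W : C} (B : A ⊗ A ⟶ A) (κ : 𝟙_ C ⟶ X ⊗ W) (f : X ⟶ A) (P : W ⟶ A) : A ⟶ A :=
  ins κ (rs X W A ≫ conv (f ▷ A ≫ B) P)

/-- Exposes `(f ⊗ₘ g) ≫ B`, so that the formula for the bracket of generators applies when `f` and
`g` are arrows. -/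
lemma comp_bracketLeg {X W Y : C} (κ : 𝟙_ C ⟶ X ⊗ W) (f : X ⟶ A) (P : W ⟶ A) (g : Y ⟶ A) :
    g ≫ bracketLeg B κ f P = ins κ (rs X W Y ≫ conv ((f ⊗ₘ g) ≫ B) P) := by
  have h : (X ⊗ W) ◁ g ≫ rs X W A = rs X W Y ≫ (X ◁ g) ▷ W := by
    simp only [rs, Category.assoc, associator_naturality_right_assoc]
    rw [← MonoidalCategory.whiskerLeft_comp_assoc, BraidedCategory.braiding_naturality_right,
      MonoidalCategory.whiskerLeft_comp_assoc, associator_inv_naturality_middle]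
  rw [bracketLeg, comp_ins, reassoc_of% h, ← comp_conv_left, MonoidalCategory.tensorHom_def']
  simp only [Category.assoc]

/-- The same diagram read in two ways: as a function of `z`, and as the derivation `{-, z}` applied
to the leg `f`. This exchange of roles allows the Leibniz expansion to be repeated in the second
word. -/
lemma point_bracketLeg {X W : C} (κ : 𝟙_ C ⟶ X ⊗ W) (f : X ⟶ A) (P : W ⟶ A) (z : 𝟙_ C ⟶ A) :
    z ≫ bracketLeg B κ f P = κ ≫ conv (f ≫ bracketPoint B z) P := by
  have h : rs X W (𝟙_ C) = (ρ_ (X ⊗ W)).hom ≫ (ρ_ X).inv ▷ W := by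
    simp [rs, braiding_tensorUnit_right]
  rw [comp_bracketLeg, h, comp_eq_ins, Category.assoc, ← comp_conv_left, bracketPoint,
    MonoidalCategory.tensorHom_def]
  simp

/-- The Leibniz rule of `B` in its second variable, multiplied by the spectator factor `P`; the two
resulting terms agree with the required ones up to a permutation settled by coherence. -/
lemma isDerivation_bracketLeg (hB : Sym.IsBiderivation B) {X W : C} (κ : 𝟙_ C ⟶ X ⊗ W)
    (f : X ⟶ A) (P : W ⟶ A) : IsDerivation (bracketLeg B κ f P) := by
  have h1 : (f ⊗ₘ MonObj.mul) ≫ B = sw X A A ≫ conv (𝟙 A) (f ▷ A ≫ B) +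
      (α_ X A A).inv ≫ conv (f ▷ A ≫ B) (𝟙 A) := by
    rw [MonoidalCategory.tensorHom_def, Category.assoc, hB.right, Preadditive.comp_add,
      ← whiskerLeft_mul, ← whiskerRight_mul, reassoc_of% sw_nat1]
    simp
  rw [IsDerivation, comp_bracketLeg, h1, bracketLeg]
  generalize f ▷ A ≫ B = b
  rw [conv_ins, ins_conv, add_conv,
    Preadditive.comp_add, ins_add, comp_conv_left, comp_conv_left, comp_conv_left, comp_conv_right,
    conv_assoc', conv_right_comm b P]
  congr 2
  · simp only [← Category.assoc]
    congr 1
    refine Struct.ext (X := ((Rep.atom 0 X).tensor (.atom 1 W)).tensor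
      ((Rep.atom 2 A).tensor (.atom 3 A))) (Y := ((Rep.atom 2 A).tensor
      ((Rep.atom 0 X).tensor (.atom 3 A))).tensor (.atom 1 W)) ?_ ?_
      (show List.Nodup [0, 1, 2, 3] by decide) <;>
    repeat' first | apply rs_struct | apply Struct.sw | constructor
  · simp only [← Category.assoc]
    congr 1
    refine Struct.ext (X := ((Rep.atom 0 X).tensor (.atom 1 W)).tensor
      ((Rep.atom 2 A).tensor (.atom 3 A))) (Y := (((Rep.atom 0 X).tensor
      (.atom 2 A)).tensor (.atom 3 A)).tensor (.atom 1 W)) ?_ ?_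
      (show List.Nodup [0, 1, 2, 3] by decide) <;>
    repeat' first | apply rs_struct | apply Struct.sw | constructor
end Derivations

/-! ### The identity strand, neutral for gluing. -/

section Identity
variable {C : Type u} [Category.{v} C] [MonoidalCategory C] [SymmetricCategory C]

/-- The identity matrix `c ⊗ cᘁ ⟶ A`: evaluation followed by the unit. -/
def idStrand (A : C) [MonObj A] (c : C) [HasRightDual c] : c ⊗ cᘁ ⟶ A :=
  (β_ c cᘁ).hom ≫ ε_ c cᘁ ≫ MonObj.one

/-- A triangle identity for the duality, with the braidings in `cup` and in front of the evaluation
cancelled by coherence. -/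
lemma cup_eval (c : C) [HasRightDual c] :
    cup c cᘁ ≫ cᘁ ◁ ((β_ c cᘁ).hom ≫ ε_ c cᘁ) = (ρ_ _).inv := by
  have h1 : (cᘁ : C) ◁ ε_ c cᘁ = (β_ _ _).hom ≫ ε_ c cᘁ ▷ (cᘁ : C) ≫ (β_ _ _).hom := by
    rw [BraidedCategory.braiding_naturality_left, SymmetricCategory.symmetry_assoc]
  have h2 : cup c (cᘁ : C) = (ρ_ _).inv ≫ (cᘁ : C) ◁ η_ c cᘁ ≫ (β_ _ _).hom ≫
      (β_ c (cᘁ : C)).hom ▷ (cᘁ : C) ≫ (α_ _ _ _).hom := by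
    rw [BraidedCategory.braiding_naturality_right_assoc, rightUnitor_inv_braiding_assoc, cup,
      coevSwap, comp_whiskerRight_assoc]
  have h3 : (β_ (cᘁ : C) (c ⊗ (cᘁ : C))).hom ≫ (β_ c (cᘁ : C)).hom ▷ (cᘁ : C) ≫ (α_ _ _ _).hom ≫
      (cᘁ : C) ◁ (β_ c (cᘁ : C)).hom ≫ (β_ (cᘁ : C) ((cᘁ : C) ⊗ c)).hom = (α_ _ _ _).inv := by
    refine Struct.ext (X := (Rep.atom 0 (cᘁ : C)).tensor ((Rep.atom 1 c).tensor (.atom 2 (cᘁ : C))))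
      (Y := ((Rep.atom 0 (cᘁ : C)).tensor (Rep.atom 1 c)).tensor (.atom 2 (cᘁ : C))) ?_ ?_
      (show List.Nodup [0, 1, 2] by decide) <;>
    repeat' constructor
  rw [MonoidalCategory.whiskerLeft_comp, h1, h2]
  simp only [Category.assoc]
  rw [reassoc_of% h3, ExactPairing.coevaluation_evaluation_assoc]
  simp

/-- Allows an empty tail to be treated as a strand, so that words of length one need no separate
case. -/
lemma glue_idStrand {A : C} [MonObj A] {x : C} (c : C) [HasRightDual c] (f : x ⊗ cᘁ ⟶ A) :
    glue c f (idStrand A c) = f := by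
  have h : (f ⊗ₘ idStrand A c) ≫ MonObj.mul =
      (x ⊗ (cᘁ : C)) ◁ ((β_ c cᘁ).hom ≫ ε_ c cᘁ) ≫ (ρ_ _).hom ≫ f := by
    rw [idStrand, MonoidalCategory.tensorHom_def', MonoidalCategory.whiskerLeft_comp,
      MonoidalCategory.whiskerLeft_comp, MonoidalCategory.whiskerLeft_comp, Category.assoc,
      Category.assoc, Category.assoc, Category.assoc, whisker_exchange_assoc, MonObj.mul_one]
    simp
  rw [glue, h]
  have h2 : x ◁ cup c cᘁ ≫ (α_ x (cᘁ : C) (c ⊗ (cᘁ : C))).inv ≫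
      (x ⊗ (cᘁ : C)) ◁ ((β_ c cᘁ).hom ≫ ε_ c cᘁ) =
      x ◁ (cup c cᘁ ≫ cᘁ ◁ ((β_ c cᘁ).hom ≫ ε_ c cᘁ)) ≫ (α_ _ _ _).inv := by
    rw [← associator_inv_naturality_right, MonoidalCategory.whiskerLeft_comp_assoc]
  rw [reassoc_of% h2, cup_eval]
  simp
end Identity

/-! ### The Leibniz rule for traces: derivatives as sums over rotations. -/

section Strands
variable {C : Type u} [Category.{v} C] [MonoidalCategory C] [SymmetricCategory C]
  [TensorCocomplete C] [Preadditive C] [MonoidalPreadditive C]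
  {Q₀ Q₁ : Type*} [Finite Q₁] (Q : QuiverOn Q₀ Q₁)
  (c : Q₀ → C) [∀ i, HasRightDual (c i)]

/-- The first vertex of a path that ends at `e`. -/
abbrev startVertex : List (Q₁ ⊕ Q₁) → Q₀ → Q₀
  | [], e => e
  | b :: _, _ => Q.src b

/-- The open strand of a possibly empty path. -/
noncomputable def tailStrand : (l : List (Q₁ ⊕ Q₁)) → (e : Q₀) →
    (c (startVertex Q l e) ⊗ (c e)ᘁ ⟶ SymHDual Q c)
  | [], e => idStrand (SymHDual Q c) (c e)
  | b :: l, e => strand Q c b l e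

lemma strand_eq (a : Q₁ ⊕ Q₁) (l : List (Q₁ ⊕ Q₁)) (e : Q₀) :
    strand Q c a l e = glue (c (startVertex Q l e)) (arrowGen Q c a (startVertex Q l e))
      (tailStrand Q c l e) := by
  cases l with
  | nil => exact (glue_idStrand _ _).symm
  | cons b l => rfl

lemma strand_append (a b : Q₁ ⊕ Q₁) (l m : List (Q₁ ⊕ Q₁)) (k : Q₀) :
    strand Q c a (l ++ b :: m) k =
      glue (c (Q.src b)) (strand Q c a l (Q.src b)) (strand Q c b m k) := by
  induction l generalizing a with
  | nil => rfl
  | cons d l ih =>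
    change glue _ _ (strand Q c d (l ++ b :: m) k) = glue _ (glue _ _ _) _
    rw [ih, glue_assoc]

variable (D : SymHDual Q c ⟶ SymHDual Q c)

/-- The open strand of a path, with `D` applied to the `n`-th arrow. -/
noncomputable def strandDer : ℕ → (a : Q₁ ⊕ Q₁) → List (Q₁ ⊕ Q₁) → (k : Q₀) →
    (c (Q.src a) ⊗ (c k)ᘁ ⟶ SymHDual Q c)
  | 0, a, l, k => glue (c (startVertex Q l k)) (arrowGen Q c a (startVertex Q l k) ≫ D)
      (tailStrand Q c l k)
  | _ + 1, _, [], _ => 0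
  | n + 1, a, b :: l, k => glue (c (Q.src b)) (arrowGen Q c a (Q.src b)) (strandDer n b l k)

lemma glue_sum {A : C} [MonObj A] {x z : C} (k : C) [HasRightDual k] (f : x ⊗ kᘁ ⟶ A)
    (s : Finset ℕ) (g : ℕ → (k ⊗ z ⟶ A)) :
    glue k f (∑ n ∈ s, g n) = ∑ n ∈ s, glue k f (g n) := by
  let F : (k ⊗ z ⟶ A) →+ (x ⊗ z ⟶ A) := AddMonoidHom.mk' (glue k f) fun g h => by
    simp [glue, MonoidalPreadditive.tensor_add]
  exact map_sum F g s

variable {D}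

lemma strand_comp (hD : IsDerivation D) (a : Q₁ ⊕ Q₁) (l : List (Q₁ ⊕ Q₁)) (k : Q₀) :
    strand Q c a l k ≫ D = ∑ n ∈ Finset.range (l.length + 1), strandDer Q c D n a l k := by
  induction l generalizing a with
  | nil =>
    simp only [List.length_nil, zero_add, Finset.sum_range_one]
    exact (glue_idStrand _ _).symm
  | cons b l ih =>
    rw [List.length_cons, Finset.sum_range_succ']
    change glue _ _ _ ≫ D = ∑ n ∈ _, glue (c (Q.src b)) _ _ + glue _ _ _
    rw [hD.glue_comp, ih, glue_sum, add_comm]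
    rfl

variable (D)

/-- The bound places the differentiated arrow inside `a :: l`, whose positions are `0, …, l.length`,
so the appended arrow is untouched. -/
lemma strandDer_snoc (n : ℕ) (a b : Q₁ ⊕ Q₁) (l : List (Q₁ ⊕ Q₁)) (k : Q₀) (h : n ≤ l.length) :
    strandDer Q c D n a (l ++ [b]) k =
      glue (c (Q.src b)) (strandDer Q c D n a l (Q.src b)) (arrowGen Q c b k) := by
  induction l generalizing a n with
  | nil =>
    obtain rfl : n = 0 := by simpa using h
    change _ = glue _ (glue _ _ (idStrand _ _)) _
    rw [glue_idStrand]
    rfl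
  | cons d l ih =>
    cases n with
    | zero =>
      change glue _ _ (strand Q c d (l ++ [b]) k) = glue _ (glue _ _ (strand Q c d l _)) _
      rw [strand_snoc, glue_assoc]
      rfl
    | succ n =>
      change glue _ _ (strandDer Q c D n d (l ++ [b]) k) = glue _ (glue _ _ _) _
      rw [ih n d (by simpa using h), glue_assoc]

/-- The trace of a word, with `D` applied to the first arrow. -/
noncomputable def traceDer : List (Q₁ ⊕ Q₁) → (𝟙_ C ⟶ SymHDual Q c)
  | [] => 0
  | a :: l => η_ (c (Q.src a)) (c (Q.src a))ᘁ ≫ strandDer Q c D 0 a l (Q.src a)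

/-- Cyclicity in the form of `trace_glue` moves the leading arrow to the end, which brings the
differentiated position one step closer to the front. -/
lemma coev_strandDer (n : ℕ) (a : Q₁ ⊕ Q₁) (l : List (Q₁ ⊕ Q₁)) (h : n ≤ l.length) :
    η_ (c (Q.src a)) (c (Q.src a))ᘁ ≫ strandDer Q c D n a l (Q.src a) =
      traceDer Q c D ((a :: l).rotate n) := by
  induction n generalizing a l with
  | zero => rw [List.rotate_zero]; rfl
  | succ n ih =>
    cases l with
    | nil => simp at h
    | cons b l =>
      have h' : n ≤ l.length := by simpa using h
      rw [List.rotate_cons_succ]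
      change η_ _ _ ≫ glue _ _ _ = _
      rw [trace_glue, ← strandDer_snoc Q c D n b a l _ h', List.cons_append,
        ih b (l ++ [a]) (by simp; omega)]

variable {D}

lemma traceWord_comp (hD : IsDerivation D) (l : List (Q₁ ⊕ Q₁)) (hl : l ≠ []) :
    CategoryStruct.comp (X := 𝟙_ C) (Y := SymHDual Q c) (traceWord Q c l) D =
      (l.cyclicPermutations.map (traceDer Q c D)).sum := by
  obtain ⟨a, l, rfl⟩ := List.exists_cons_of_ne_nil hl
  -- Rotations are counted with multiplicity, one for each position, also when the word is periodic.
  have h : (a :: l).cyclicPermutations = (List.range (l.length + 1)).map (a :: l).rotate := by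
    refine List.ext_getElem (by simp) fun n h1 h2 => ?_
    rw [List.getElem_cyclicPermutations]; simp
  have h1 : CategoryStruct.comp (X := 𝟙_ C) (Y := SymHDual Q c) (traceWord Q c (a :: l)) D =
      ∑ n ∈ Finset.range (l.length + 1), traceDer Q c D ((a :: l).rotate n) := by
    change (η_ _ _ ≫ strand Q c a l _) ≫ D = _
    rw [Category.assoc, strand_comp Q c hD, Preadditive.comp_sum]
    exact Finset.sum_congr rfl fun n hn =>
      coev_strandDer Q c D n a l (Nat.lt_succ_iff.1 (Finset.mem_range.1 hn))
  rw [h1, h, List.map_map]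
  rfl

lemma traceDer_cons (D : SymHDual Q c ⟶ SymHDual Q c) (a : Q₁ ⊕ Q₁) (l : List (Q₁ ⊕ Q₁)) :
    traceDer Q c D (a :: l) = closing (η_ (c (Q.src a)) (c (Q.src a))ᘁ)
      (η_ (c (startVertex Q l (Q.src a))) (c (startVertex Q l (Q.src a)))ᘁ) ≫
      conv (arrowGen Q c a (startVertex Q l (Q.src a)) ≫ D) (tailStrand Q c l (Q.src a)) :=
  coev_glue _ _ _ _

/-- The derivation `z ↦ {-, z}` applied to the first arrow of a word, as a function of `z`. -/
noncomputable def wordDer (B : SymHDual Q c ⊗ SymHDual Q c ⟶ SymHDual Q c) :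
    List (Q₁ ⊕ Q₁) → (SymHDual Q c ⟶ SymHDual Q c)
  | [] => 0
  | a :: l => bracketLeg B (closing (η_ (c (Q.src a)) (c (Q.src a))ᘁ)
      (η_ (c (startVertex Q l (Q.src a))) (c (startVertex Q l (Q.src a)))ᘁ))
      (arrowGen Q c a (startVertex Q l (Q.src a))) (tailStrand Q c l (Q.src a))

lemma traceDer_bracketPoint (B : SymHDual Q c ⊗ SymHDual Q c ⟶ SymHDual Q c)
    (z : 𝟙_ C ⟶ SymHDual Q c) (l : List (Q₁ ⊕ Q₁)) :
    traceDer Q c (bracketPoint B z) l = z ≫ wordDer Q c B l := by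
  cases l with
  | nil => exact (Limits.comp_zero).symm
  | cons a l => rw [traceDer_cons, wordDer, point_bracketLeg]

lemma isDerivation_wordDer {B : SymHDual Q c ⊗ SymHDual Q c ⟶ SymHDual Q c}
    (hB : Sym.IsBiderivation B) (l : List (Q₁ ⊕ Q₁)) : IsDerivation (wordDer Q c B l) := by
  cases l with
  | nil => simp [IsDerivation, wordDer, conv]
  | cons a l => exact isDerivation_bracketLeg hB _ _ _

/-- `traceWord_comp` applied twice: to `{-, tr m}` on the first word, and then, after
`traceDer_bracketPoint` has exchanged the roles, to `wordDer` on the second. -/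
lemma op_traceWord {B : SymHDual Q c ⊗ SymHDual Q c ⟶ SymHDual Q c}
    (hB : Sym.IsBiderivation B) (l m : List (Q₁ ⊕ Q₁)) (hl : l ≠ []) (hm : m ≠ []) :
    @Eq (𝟙_ C ⟶ SymHDual Q c) (Points.op B (traceWord Q c l) (traceWord Q c m))
      (l.cyclicPermutations.map fun l' => (m.cyclicPermutations.map fun m' =>
        traceDer Q c (wordDer Q c B l') m').sum).sum := by
  refine (op_eq B _ _).trans
    ((traceWord_comp Q c (isDerivation_bracketPoint hB _) l hl).trans ?_)
  congr 1
  refine List.map_congr_left fun l' _ => ?_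
  exact (traceDer_bracketPoint Q c B _ l').trans <| traceWord_comp Q c (isDerivation_wordDer Q c hB l') m hm
end Strands

/-! ### Evaluation of the bracket on a pair of first arrows. -/

section Bracket
variable {C : Type u} [Category.{v} C] [MonoidalCategory C] [SymmetricCategory C]
  [TensorCocomplete C] [Preadditive C] [MonoidalPreadditive C]
  {Q₀ Q₁ : Type*} [Fintype Q₁] [DecidableEq Q₁] (Q : QuiverOn Q₀ Q₁)
  (c : Q₀ → C) [∀ i, HasRightDual (c i)]

lemma isBiderivation_poissonPlus : Sym.IsBiderivation (poissonPlus Q c) :=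
  (Sym.existsUnique_biderivation (plusOnGenerators Q c)).choose_spec.1.1

lemma gen_poissonPlus :
    (Sym.gen (hDual Q c) ⊗ₘ Sym.gen (hDual Q c)) ≫ poissonPlus Q c = plusOnGenerators Q c :=
  (Sym.existsUnique_biderivation (plusOnGenerators Q c)).choose_spec.1.2

lemma ι_plusOnGenerators (a b : Q₁ ⊕ Q₁) :
    (biproduct.ι (hDualArrow Q c) a ⊗ₘ biproduct.ι (hDualArrow Q c) b) ≫ plusOnGenerators Q c =
      pairing a b • plusDiagram Q c a b := by
  rw [plusOnGenerators, Preadditive.comp_sum, Finset.sum_eq_single a, Preadditive.comp_sum,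
    Finset.sum_eq_single b]
  · rw [MonoidalCategory.tensorHom_comp_tensorHom_assoc, biproduct.ι_π_self, biproduct.ι_π_self]
    simp
  · intro b' _ h
    rw [MonoidalCategory.tensorHom_comp_tensorHom_assoc, biproduct.ι_π_ne _ h.symm]
    simp
  · simp
  · intro a' _ h
    rw [Preadditive.comp_sum]
    refine Finset.sum_eq_zero fun b' _ => ?_
    rw [MonoidalCategory.tensorHom_comp_tensorHom_assoc, biproduct.ι_π_ne _ h.symm]
    simp
  · simp

lemma arrowGen_tgt (a : Q₁ ⊕ Q₁) : arrowGen Q c a (Q.tgt a) =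
    biproduct.ι (hDualArrow Q c) a ≫ Sym.gen (hDual Q c) := by
  simp [arrowGen]

lemma arrowGen_ne (a : Q₁ ⊕ Q₁) {k : Q₀} (h : k ≠ Q.tgt a) : arrowGen Q c a k = 0 := by
  simp [arrowGen, h]

lemma arrowGen_poissonPlus (a b : Q₁ ⊕ Q₁) (k l : Q₀) :
    (arrowGen Q c a k ⊗ₘ arrowGen Q c b l) ≫ poissonPlus Q c =
      pairing a b • ins (η_ (c (Q.src b)) (c (Q.src b))ᘁ) (ins (η_ (c (Q.src a)) (c (Q.src a))ᘁ)
        (plusPerm _ _ _ _ _ _ ≫ conv (conv (arrowGen Q c a k) (arrowGen Q c a (Q.src b)))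
          (conv (arrowGen Q c b l) (arrowGen Q c b (Q.src a))))) := by
  -- If `k` or `l` is a wrong endpoint, a factor `arrowGen` vanishes on each side; otherwise this is
  -- the defining value of the bracket on generators.
  by_cases hk : k = Q.tgt a
  · by_cases hl : l = Q.tgt b
    · subst hk hl
      rw [← ins_convPlus]
      conv_lhs => rw [arrowGen_tgt, arrowGen_tgt, ← MonoidalCategory.tensorHom_comp_tensorHom,
        Category.assoc, gen_poissonPlus, ι_plusOnGenerators]
      rfl
    · rw [arrowGen_ne Q c b hl]; simp [conv, ins]
  · rw [arrowGen_ne Q c a hk]; simp [conv, ins]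

/-- The trace of the long word is cut into the strands `a u a` and `b v b`, each with its tail
isolated, and `merge` recognises the bracket of the two first arrows. -/
lemma traceDer_wordDer (a b : Q₁ ⊕ Q₁) (l m : List (Q₁ ⊕ Q₁)) :
    traceDer Q c (wordDer Q c (poissonPlus Q c) (a :: l)) (b :: m) =
      pairing a b • (show 𝟙_ C ⟶ SymHDual Q c from
        traceWord Q c ((a :: l) ++ [a] ++ (b :: m) ++ [b])) := by
  have h : (show 𝟙_ C ⟶ SymHDual Q c from
      traceWord Q c ((a :: l) ++ [a] ++ (b :: m) ++ [b])) =
      η_ _ _ ≫ glue (c (Q.src b)) (glue (c (Q.src a)) (strand Q c a l (Q.src a))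
        (arrowGen Q c a (Q.src b))) (glue (c (Q.src b)) (strand Q c b m (Q.src b))
          (arrowGen Q c b (Q.src a))) := by
    have e : (a :: l) ++ [a] ++ (b :: m) ++ [b] = a :: ((l ++ [a]) ++ b :: (m ++ [b])) := by simp
    rw [e]
    change η_ _ _ ≫ strand Q c a ((l ++ [a]) ++ b :: (m ++ [b])) _ = _
    rw [strand_append, strand_snoc, strand_snoc]
  rw [h, coev_glue, strand_eq Q c a, strand_eq Q c b, glue_glue_eq, glue_glue_eq, ← merge, traceDer_cons,
    wordDer, comp_bracketLeg, arrowGen_poissonPlus]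
  generalize pairing a b = n
  generalize ins (η_ (c (Q.src b)) (c (Q.src b))ᘁ) _ = t
  -- The diagrams now agree; it remains to pull the integer `⟨a, b⟩` out of the products and
  -- insertions.
  have h1 : ∀ {x y : C} (f : x ⟶ SymHDual Q c) (g : y ⟶ SymHDual Q c),
      conv (n • f) g = n • conv f g := by
    intro x y f g
    exact map_zsmul (AddMonoidHom.mk' (fun f => conv f g) fun f f' => add_conv f f' g) n f
  have h2 : ∀ {V x y : C} (ω : 𝟙_ C ⟶ V) (g : V ⊗ x ⟶ y), ins ω (n • g) = n • ins ω g := by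
    intro V x y ω g
    simp [ins]
  rw [h1, Preadditive.comp_zsmul, h2, h1, Preadditive.comp_zsmul]

end Bracket

/-! ### The induced bracket on the algebra of points. -/

section PointsDer
variable {C : Type u} [Category.{v} C] [MonoidalCategory C] [SymmetricCategory C]
  [Preadditive C] [MonoidalPreadditive C] {A : C} [MonObj A] [IsCommMonObj A]

/-- Apply a map to a point. -/
def Points.map {A B : C} (D : A ⟶ B) (f : Points A) : Points B :=
  CategoryStruct.comp (X := 𝟙_ C) (Y := A) f D

lemma Points.map_mul {D : A ⟶ A} (hD : IsDerivation D) (f g : Points A) :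
    Points.map D (f * g) = f * Points.map D g + g * Points.map D f := by
  rw [mul_comm g]
  have h : ∀ f g : 𝟙_ C ⟶ A, ((λ_ (𝟙_ C)).inv ≫ conv f g) ≫ D =
      (λ_ (𝟙_ C)).inv ≫ conv f (g ≫ D) + (λ_ (𝟙_ C)).inv ≫ conv (f ≫ D) g := by
    intro f g
    rw [Category.assoc, hD.conv_comp, Preadditive.comp_add, add_comm]
  exact h f g

lemma IsDerivation.one_comp {D : A ⟶ A} (hD : IsDerivation D) : MonObj.one ≫ D = 0 := by
  have h := Points.map_mul hD (1 : Points A) 1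
  rw [one_mul, one_mul, left_eq_add] at h
  exact h

lemma Points.op_eq_map (B : A ⊗ A ⟶ A) (f z : Points A) :
    Points.op B f z = Points.map (bracketPoint B z) f := op_eq B f z

/-- Bracketing with `f` on the left is a degenerate `bracketLeg`: both legs of the point are the
unit object and the spectator factor is `1`. The derivation property in the second variable is thus
already available. -/
lemma Points.op_eq_map' (B : A ⊗ A ⟶ A) (f z : Points A) :
    Points.op B f z = Points.map (bracketLeg B (λ_ (𝟙_ C)).inv f MonObj.one) z := by
  refine (op_eq B f z).trans (Eq.trans ?_ (point_bracketLeg (λ_ (𝟙_ C)).inv f MonObj.one z).symm)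
  exact (mul_one (M := Points A) (CategoryStruct.comp (X := 𝟙_ C) (Y := A) f
    (bracketPoint B z))).symm

variable {B : A ⊗ A ⟶ A}

lemma Points.op_mul_left (hB : Sym.IsBiderivation B) (f g h : Points A) :
    Points.op B (f * g) h = f * Points.op B g h + g * Points.op B f h := by
  simp only [Points.op_eq_map]
  exact Points.map_mul (isDerivation_bracketPoint hB _) f g

lemma Points.op_mul_right (hB : Sym.IsBiderivation B) (f g h : Points A) :
    Points.op B f (g * h) = g * Points.op B f h + h * Points.op B f g := by
  simp only [Points.op_eq_map']
  exact Points.map_mul (isDerivation_bracketLeg hB _ _ _) g h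

/-- Derivations kill the unit, hence also its scalar multiples. With `Points.op_scalar_right` this
covers the circles, the traces of constant paths. -/
lemma Points.op_scalar_left (hB : Sym.IsBiderivation B) (s : 𝟙_ C ⟶ 𝟙_ C) (z : Points A) :
    Points.op B (s ≫ MonObj.one : 𝟙_ C ⟶ A) z = 0 := by
  refine (op_eq B _ _).trans ?_
  rw [Category.assoc, (isDerivation_bracketPoint hB z).one_comp, Limits.comp_zero]
  rfl

lemma Points.op_scalar_right (hB : Sym.IsBiderivation B) (s : 𝟙_ C ⟶ 𝟙_ C) (z : Points A) :
    Points.op B z (s ≫ MonObj.one : 𝟙_ C ⟶ A) = 0 := by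
  refine (Points.op_eq_map' B _ _).trans ?_
  refine (Category.assoc _ _ _).trans (Eq.trans ?_ (Limits.comp_zero (f := s)))
  exact congrArg _ (isDerivation_bracketLeg hB _ _ _).one_comp

variable (R : Type w) [CommRing R] [Linear R C] [MonoidalLinear R C]

/-- The operation `Points.op` as a bilinear map. -/
noncomputable def Points.opHom (B : A ⊗ A ⟶ A) : Points A →ₗ[R] Points A →ₗ[R] Points A :=
  LinearMap.mk₂ R (Points.op B)
    (fun (f g h : 𝟙_ C ⟶ A) => by
      change (λ_ (𝟙_ C)).inv ≫ ((f + g) ⊗ₘ h) ≫ B =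
        (λ_ (𝟙_ C)).inv ≫ (f ⊗ₘ h) ≫ B + (λ_ (𝟙_ C)).inv ≫ (g ⊗ₘ h) ≫ B
      simp [MonoidalPreadditive.add_tensor])
    (fun r (f g : 𝟙_ C ⟶ A) => by
      change (λ_ (𝟙_ C)).inv ≫ ((r • f) ⊗ₘ g) ≫ B = r • ((λ_ (𝟙_ C)).inv ≫ (f ⊗ₘ g) ≫ B)
      simp [MonoidalCategory.tensorHom_def])
    (fun (f g h : 𝟙_ C ⟶ A) => by
      change (λ_ (𝟙_ C)).inv ≫ (f ⊗ₘ (g + h)) ≫ B =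
        (λ_ (𝟙_ C)).inv ≫ (f ⊗ₘ g) ≫ B + (λ_ (𝟙_ C)).inv ≫ (f ⊗ₘ h) ≫ B
      simp [MonoidalPreadditive.tensor_add])
    (fun r (f g : 𝟙_ C ⟶ A) => by
      change (λ_ (𝟙_ C)).inv ≫ (f ⊗ₘ (r • g)) ≫ B = r • ((λ_ (𝟙_ C)).inv ≫ (f ⊗ₘ g) ≫ B)
      simp [MonoidalCategory.tensorHom_def])

end PointsDer

/-! ### Derivations along an algebra map out of a symmetric algebra. -/

section Ext
variable {R : Type w} [CommRing R] {ι P : Type*} [CommRing P] [Algebra R P]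

/-- Taken with `φ = tr`, this reduces the intertwining identity to cyclic paths, one variable at a
time. -/
lemma symAlgHom_der_ext (φ : SymmetricAlgebra R (ι →₀ R) →ₐ[R] P)
    (F G : SymmetricAlgebra R (ι →₀ R) →ₗ[R] P)
    (hF : ∀ a b, F (a * b) = φ a * F b + φ b * F a)
    (hG : ∀ a b, G (a * b) = φ a * G b + φ b * G a)
    (h : ∀ i, F (SymmetricAlgebra.ι R _ (Finsupp.single i 1)) =
      G (SymmetricAlgebra.ι R _ (Finsupp.single i 1))) : F = G := by
  have one : ∀ H : SymmetricAlgebra R (ι →₀ R) →ₗ[R] P,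
      (∀ a b, H (a * b) = φ a * H b + φ b * H a) → H 1 = 0 := by
    intro H hH
    have := hH 1 1
    simpa using this
  have h' : F ∘ₗ SymmetricAlgebra.ι R _ = G ∘ₗ SymmetricAlgebra.ι R _ :=
    Finsupp.lhom_ext' fun i => LinearMap.ext_ring (h i)
  ext x
  induction x using SymmetricAlgebra.induction with
  | algebraMap r => simp [Algebra.algebraMap_eq_smul_one, one F hF, one G hG]
  | ι m => exact LinearMap.congr_fun h' m
  | mul a b ha hb => rw [hF, hG, ha, hb]
  | add a b ha hb => rw [map_add, map_add, ha, hb]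
end Ext

/-! ### Comparison on cyclic paths, and the theorem. -/

section Main
variable {R : Type w} [CommRing R]
    {C : Type u} [Category.{v} C] [MonoidalCategory C] [SymmetricCategory C]
    [Preadditive C] [MonoidalPreadditive C] [Linear R C] [MonoidalLinear R C] [TensorCocomplete C]
    {Q₀ Q₁ : Type*} [Fintype Q₁] [DecidableEq Q₁] (Q : QuiverOn Q₀ Q₁)
    (c : Q₀ → C) [∀ i, HasRightDual (c i)]

lemma tr_ι (x : Necklaces Q R) : tr Q c R (SymmetricAlgebra.ι R _ x) =
    Finsupp.linearCombination R (tracePath Q c) x := by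
  rw [tr, SymmetricAlgebra.lift_ι_apply]

lemma tr_pathGen (p : CyclicPath Q) : tr Q c R (pathGen Q R p) = tracePath Q c p := by
  rw [pathGen, tr_ι, Finsupp.linearCombination_single, one_smul]

/-- A nonzero pairing means that `a` and `b` are mutually reversed, so each ends where the other
starts. Therefore the default value `0` of `wordClass` never meets a nonzero coefficient in the
bracket of closed words. -/
lemma chain_bracketWord (a b : Q₁ ⊕ Q₁) (l m : List (Q₁ ⊕ Q₁)) (h : pairing a b ≠ 0)
    (hl : ((a :: l : List _) : Cycle (Q₁ ⊕ Q₁)).Chain fun a b => Q.tgt a = Q.src b)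
    (hm : ((b :: m : List _) : Cycle (Q₁ ⊕ Q₁)).Chain fun a b => Q.tgt a = Q.src b) :
    (((a :: l) ++ [a] ++ (b :: m) ++ [b] : List _) : Cycle (Q₁ ⊕ Q₁)).Chain
      fun a b => Q.tgt a = Q.src b := by
  have h1 : Q.tgt a = Q.src b ∧ Q.tgt b = Q.src a := by
    rcases a with a | a <;> rcases b with b | b <;>
      simp_all [pairing, QuiverOn.src, QuiverOn.tgt]
  have e : (a :: l) ++ [a] ++ (b :: m) ++ [b] = a :: (l ++ [a] ++ (b :: m) ++ [b]) := by simp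
  rw [e, Cycle.chain_coe_cons]
  rw [Cycle.chain_coe_cons] at hl hm
  -- The chain conditions of `a u a` and `b v b` are exactly the closedness of the two given words;
  -- the junctions `a b` and, on closing up, `b a` are new.
  have e' : a :: (l ++ [a] ++ (b :: m) ++ [b] ++ [a]) =
    (a :: (l ++ [a])) ++ ((b :: (m ++ [b])) ++ [a]) := by simp
  rw [e', List.isChain_append, List.isChain_append]
  refine ⟨hl, ⟨hm, by simp, ?_⟩, ?_⟩
  · intro x hx y hy
    have e1 : b :: (m ++ [b]) = (b :: m) ++ [b] := by simp
    rw [e1, List.getLast?_concat] at hx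
    simp at hx hy
    subst hx hy
    exact h1.2
  · intro x hx y hy
    have e1 : a :: (l ++ [a]) = (a :: l) ++ [a] := by simp
    rw [e1, List.getLast?_concat] at hx
    simp at hx hy
    subst hx hy
    exact h1.1

lemma linearCombination_brPlusTerm (l m : List (Q₁ ⊕ Q₁)) (hl₀ : l ≠ []) (hm₀ : m ≠ [])
    (hl : (l : Cycle (Q₁ ⊕ Q₁)).Chain fun a b => Q.tgt a = Q.src b)
    (hm : (m : Cycle (Q₁ ⊕ Q₁)).Chain fun a b => Q.tgt a = Q.src b) :
    Finsupp.linearCombination R (tracePath Q c) (brPlusTerm Q R l m) =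
      traceDer Q c (wordDer Q c (poissonPlus Q c) l) m := by
  obtain ⟨a, l, rfl⟩ := List.exists_cons_of_ne_nil hl₀
  obtain ⟨b, m, rfl⟩ := List.exists_cons_of_ne_nil hm₀
  refine Eq.trans ?_ (traceDer_wordDer Q c a b l m).symm
  rw [brPlusTerm, map_zsmul]
  by_cases h : pairing a b = 0
  · rw [h, zero_smul, zero_smul]; rfl
  · have hc := chain_bracketWord Q a b l m h hl hm
    rw [wordClass, dif_pos ⟨by simp [Cycle.coe_eq_nil], hc⟩, Finsupp.linearCombination_single,
      one_smul]
    rfl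

lemma op_tracePath (p q : CyclicPath Q) :
    Points.op (poissonPlus Q c) (tracePath Q c p) (tracePath Q c q) =
      Finsupp.linearCombination R (tracePath Q c) (brPlusPath Q R p q) := by
  have hB := isBiderivation_poissonPlus Q c
  cases p with
  | const i =>
    have e : brPlusPath Q R (.const i) q = 0 := by cases q <;> rfl
    rw [e, map_zero]
    exact Points.op_scalar_left hB _ _
  | word p hp hp' =>
    cases q with
    | const i =>
      have e : brPlusPath Q R (.word p hp hp') (.const i) = 0 := rfl
      rw [e, map_zero]
      exact Points.op_scalar_right hB _ _
    | word q hq hq' =>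
      induction p using Quotient.inductionOn with | _ l
      induction q using Quotient.inductionOn with | _ m
      have hl : l ≠ [] := by rintro rfl; exact hp rfl
      have hm : m ≠ [] := by rintro rfl; exact hq rfl
      refine (op_traceWord Q c hB l m hl hm).trans ?_
      -- On representatives, the multiset of lists of a cycle is its list of cyclic permutations, so
      -- the two double sums can be compared term by term.
      have e : brPlusPath Q R (.word (l : Cycle _) hp hp') (.word (m : Cycle _) hq hq') =
          (l.cyclicPermutations.map fun l' => (m.cyclicPermutations.map fun m' =>
            brPlusTerm Q R l' m').sum).sum := by
        simp [brPlusPath]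
      refine Eq.trans ?_ (congrArg _ e.symm)
      rw [map_list_sum, List.map_map]
      refine congrArg List.sum (List.map_congr_left fun l' h1 => ?_)
      rw [Function.comp_apply, map_list_sum, List.map_map]
      refine congrArg List.sum (List.map_congr_left fun m' h2 => ?_)
      have h1 := List.mem_cyclicPermutations_iff.1 h1
      have h2 := List.mem_cyclicPermutations_iff.1 h2
      -- Nonemptiness and closedness pass to rotations, since a rotation represents the same cycle.
      refine (linearCombination_brPlusTerm Q c l' m' ?_ ?_ ?_ ?_).symm
      · rintro rfl; exact hl (List.isRotated_nil_iff'.1 h1).symm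
      · rintro rfl; exact hm (List.isRotated_nil_iff'.1 h2).symm
      · rwa [Cycle.coe_eq_coe.2 h1]
      · rwa [Cycle.coe_eq_coe.2 h2]

end Main
end NecklaceTrace

open NecklaceTrace
theorem mainTheorem7 {R : Type w} [CommRing R]
    {C : Type u} [Category.{v} C] [MonoidalCategory C] [SymmetricCategory C]
    [Preadditive C] [MonoidalPreadditive C] [Linear R C] [MonoidalLinear R C] [TensorCocomplete C]
    {Q₀ Q₁ : Type*} [Finite Q₀] [Fintype Q₁] [DecidableEq Q₁] (Q : QuiverOn Q₀ Q₁)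
    (c : Q₀ → C) [∀ i, HasRightDual (c i)] :
    (∀ i : Q₀, tr Q c R (pathGen Q R (.const i)) =
      circle (c i) ≫ MonObj.one (X := SymHDual Q c)) ∧
    (∀ (l : List (Q₁ ⊕ Q₁)) (ne : (l : Cycle (Q₁ ⊕ Q₁)) ≠ Cycle.nil)
      (closed : (l : Cycle (Q₁ ⊕ Q₁)).Chain fun a b => Q.tgt a = Q.src b),
      tr Q c R (pathGen Q R (.word (l : Cycle (Q₁ ⊕ Q₁)) ne closed)) = traceWord Q c l) ∧
    ∀ X Y : SymNecklaces Q R,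
      tr Q c R (symBrPlus Q R X Y) = Points.op (poissonPlus Q c) (tr Q c R X) (tr Q c R Y) := by
  refine ⟨fun i => tr_pathGen Q c _, fun l ne closed => tr_pathGen Q c _, ?_⟩
  have hB := isBiderivation_poissonPlus Q c
  obtain ⟨h1, h2, h3⟩ : (∀ F G H, symBrPlus Q R (F * G) H =
      F * symBrPlus Q R G H + G * symBrPlus Q R F H) ∧
      (∀ F G H, symBrPlus Q R F (G * H) = G * symBrPlus Q R F H + symBrPlus Q R F G * H) ∧
      ∀ m n, symBrPlus Q R (SymmetricAlgebra.ι R _ m) (SymmetricAlgebra.ι R _ n) =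
        SymmetricAlgebra.ι R _ (brPlus Q R m n) :=
    (existsUnique_symBracket (brPlus Q R)).choose_spec.1
  let O := Points.opHom R (poissonPlus Q c)
  -- The left argument is first held at a generator while the right one varies; the same extension
  -- argument in the left variable then finishes.
  have key : ∀ p Y, tr Q c R (symBrPlus Q R (pathGen Q R p) Y) =
      Points.op (poissonPlus Q c) (tr Q c R (pathGen Q R p)) (tr Q c R Y) := by
    intro p
    refine LinearMap.congr_fun (symAlgHom_der_ext (tr Q c R)
      ((tr Q c R).toLinearMap ∘ₗ symBrPlus Q R (pathGen Q R p))
      (O (tr Q c R (pathGen Q R p)) ∘ₗ (tr Q c R).toLinearMap) ?_ ?_ ?_)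
    · intro a b
      simp only [LinearMap.comp_apply, AlgHom.toLinearMap_apply, h2, map_add, map_mul]
      rw [mul_comm (tr Q c R b)]
    · intro a b
      simp only [LinearMap.comp_apply, AlgHom.toLinearMap_apply, map_mul]
      exact Points.op_mul_right hB _ _ _
    · intro q
      refine Eq.trans ?_ (Eq.trans (op_tracePath (R := R) Q c p q).symm ?_)
      · simp only [LinearMap.comp_apply, AlgHom.toLinearMap_apply]
        rw [pathGen, h3, tr_ι]
        simp [brPlus]
      · rw [← tr_pathGen (R := R), ← tr_pathGen (R := R)]
        rfl
  intro X Y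
  refine LinearMap.congr_fun (symAlgHom_der_ext (tr Q c R)
    ((tr Q c R).toLinearMap ∘ₗ (symBrPlus Q R).flip Y)
    (O.flip (tr Q c R Y) ∘ₗ (tr Q c R).toLinearMap) ?_ ?_ ?_) X
  · intro a b
    simp only [LinearMap.comp_apply, AlgHom.toLinearMap_apply, LinearMap.flip_apply, h1, map_add,
      map_mul]
  · intro a b
    simp only [LinearMap.comp_apply, AlgHom.toLinearMap_apply, map_mul]
    exact Points.op_mul_left hB _ _ _
  · intro p
    exact key p Y
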